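/- Circuit model. Let $n\in\mathbb{N}$ and $L\ge 1$, and let $\mathcal N$ be a single-qubit quantum channel (a linear, completely positive, trace-preserving map) that is not a unitary channel, i.e. not of the form $A\mapsto WAW^\dagger$ with $W$ unitary. A noisy random circuit of depth $L$ on $n$ qubits is $$\Phi=\mathcal V^{\mathrm{single}}\circ\mathcal N^{\otimes n}\circ\mathcal U_L\circ\cdots\circ\mathcal N^{\otimes n}\circ\mathcal U_1 .$$ Here $\mathcal U_i=U_i(\cdot)U_i^\dagger$, where $U_i$ is a product of two-qubit gates placed in an arbitrary fixed geometry (no geometric locality is assumed) such that every qubit is acted on by at least one gate of each layer $U_i$; and $\mathcal V^{\mathrm{single}}=V(\cdot)V^\dagger$ with $V=\bigotimes_{q=1}^n u_q$ a layer of single-qubit gates. All gates are independent, and each of them is distributed according to a unitary 2-design, i.e. a probability distribution $\nu$ with $\mathbb E_{U\sim\nu}[U^{\otimes2}OU^{\dagger\otimes2}]=\mathbb E_{U\sim\mathrm{Haar}}[U^{\otimes2}OU^{\dagger\otimes2}]$ for all $O$; different gates may follow different 2-designs. $\mathbb E_\Phi$ is the expectation over all gates. For $l\le L$ let $\Phi_{(l)}=\mathcal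 V^{\mathrm{single}}\circ\mathcal N^{\otimes n}\circ\mathcal U_L\circ\cdots\circ\mathcal N^{\otimes n}\circ\mathcal U_{L-l+1}$ be the circuit in which only the last $l$ layers are kept (with the same gates). For $P\in\{I,X,Y,Z\}^{\otimes n}$ let $|P|$ be the number of tensor factors different from $I$. Normal form. $\mathcal N$ has a normal form with parameters $\mathbf t=(t_X,t_Y,t_Z)$ and $\mathbf D=(D_X,D_Y,D_Z)\in\mathbb R^3$ if $\mathcal N(A)=W\mathcal N'(V^\dagger AV)W^\dagger$ for all $A$, with unitaries $W,V$ and a channel $\mathcal N'$ such that $\mathcal N'(I)=I+t_XX+t_YY+t_ZZ$ and $\mathcal N'(Q)=D_QQ$ for $Q\in\{X,Y,Z\}$. Put $c=\tfrac13(\|\mathbf t\|_2^2+\|\mathbf D\|_2^2)$. Theorem. Every such $\mathcal N$ has a normal form, and for every normal form of $\mathcal N$ we have $c<1$ and the following bounds, for all $n$, all $L\ge1$, all noisy random circuits $\Phi$ of depth $L$ on $n$ qubits and all $P\in\{I,X,Y,Z\}^{\otimes n}$. 1. For all $n$-qubit states $\rho,\sigma$, $$\mathbb E_\Phi\big[\operatorname{Tr}(P\,\Phi(\rho-\sigma))^2\big]\le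 4\,c^{|P|+L-1}.$$ 2. For every $n$-qubit state $\rho_0$ and all $1\le l\le L$, $$\mathbb E_\Phi\big[|\operatorname{Tr}(P\,\Phi(\rho_0))-\operatorname{Tr}(P\,\Phi_{(l)}(\rho_0))|^2\big]\le 4\,c^{|P|+l-1}.$$ Consequently, with constants $\kappa>0$ and $m_0,l_0\in\mathbb N$ that depend only on $\mathcal N$ (not on $n$, $L$, the circuit, $P$ or the states): 3. $\mathbb E_\Phi[\operatorname{Tr}(P\Phi(\rho-\sigma))^2]\le e^{-\kappa(L+|P|)}$ whenever $L\ge1$ and $L+|P|\ge m_0$; 4. $\mathbb E_\Phi[|\operatorname{Tr}(P\Phi(\rho_0))-\operatorname{Tr}(P\Phi_{(l)}(\rho_0))|]\le e^{-\kappa l}$ whenever $l_0\le l\le L$. -/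

import Mathlib

open MeasureTheory
open scoped ComplexOrder

noncomputable section

namespace NoisyCircuit

/-! Unitary groups, Haar measure and unitary 2-designs -/

/-- The unitary group of the Hilbert space with orthonormal basis `ι`. -/
abbrev U (ι : Type) [Fintype ι] [DecidableEq ι] : Type :=
  ↥(Matrix.unitaryGroup ι ℂ)

section Unitary

variable (ι : Type) [Fintype ι] [DecidableEq ι]

/-- The unitary group carries its Borel sigma-algebra. -/
instance instMeasurableSpaceU : MeasurableSpace (U ι) := borel (U ι)

instance instBorelSpaceU : BorelSpace (U ι) := ⟨rfl⟩

instance instCompactSpaceU : CompactSpace (U ι) := by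
  refine isCompact_iff_compactSpace.mp ?_
  have hK : IsCompact (Set.pi Set.univ
      (fun _ : ι => Set.pi Set.univ (fun _ : ι => Metric.closedBall (0 : ℂ) 1))) :=
    isCompact_univ_pi fun _ => isCompact_univ_pi fun _ => isCompact_closedBall 0 1
  refine IsCompact.of_isClosed_subset hK ?_ ?_
  · have h : ((Matrix.unitaryGroup ι ℂ : Submonoid (Matrix ι ι ℂ)) : Set (Matrix ι ι ℂ)) =
        {A : Matrix ι ι ℂ | A * star A = 1} := by
      ext A
      exact Matrix.mem_unitaryGroup_iff
    rw [h]
    exact isClosed_eq (by fun_prop) continuous_const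
  · intro A hA i _ j _
    simpa using entry_norm_bound_of_unitary hA i j

/-- The Haar probability measure on the unitary group. -/
def haarU : Measure (U ι) := Measure.haarMeasure ⊤

end Unitary

section Design

variable {ι : Type} [Fintype ι] [DecidableEq ι]

/-- The `(i, j)` entry of the second moment `E[U^{⊗2} O U^{†⊗2}]` for `U` distributed as `ν`. -/
def secondMoment (ν : Measure (U ι)) (O : Matrix (ι × ι) (ι × ι) ℂ) :
    Matrix (ι × ι) (ι × ι) ℂ :=
  Matrix.of fun i j => ∫ u : U ι,
    (Matrix.kronecker u.1 u.1 * O * (Matrix.kronecker u.1 u.1).conjTranspose) i j ∂ν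

/-- A probability distribution on the unitary group is a 2-design if its second moments agree
with those of the Haar measure. -/
structure IsTwoDesign (ν : Measure (U ι)) : Prop where
  isProb : IsProbabilityMeasure ν
  moment : ∀ O : Matrix (ι × ι) (ι × ι) ℂ, secondMoment ν O = secondMoment (haarU ι) O

end Design

/-! Single-qubit channels -/

/-- Operators on one qubit. -/
abbrev Op1 : Type := Matrix (Fin 2) (Fin 2) ℂ

/-- The amplification `N ⊗ id` with a `d`-dimensional ancilla. -/
def amplify (N : Op1 →ₗ[ℂ] Op1) (d : ℕ) (S : Matrix (Fin 2 × Fin d) (Fin 2 × Fin d) ℂ) :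
    Matrix (Fin 2 × Fin d) (Fin 2 × Fin d) ℂ :=
  Matrix.of fun x y => N (Matrix.of fun a b => S (a, x.2) (b, y.2)) x.1 y.1

/-- A single-qubit quantum channel: a linear, completely positive, trace-preserving map. -/
structure IsChannel (N : Op1 →ₗ[ℂ] Op1) : Prop where
  completelyPositive : ∀ (d : ℕ) (S : Matrix (Fin 2 × Fin d) (Fin 2 × Fin d) ℂ),
    S.PosSemidef → (amplify N d S).PosSemidef
  tracePreserving : ∀ A : Op1, (N A).trace = A.trace

/-- `N` is a unitary channel, that is, `N(A) = W A W†` for a unitary `W`. -/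
def IsUnitaryChannel (N : Op1 →ₗ[ℂ] Op1) : Prop :=
  ∃ W : U (Fin 2), ∀ A : Op1, N A = W.1 * A * W.1.conjTranspose

/-- The single-qubit Pauli matrices `I, X, Y, Z`, indexed by `0, 1, 2, 3`. -/
def pauli : Fin 4 → Op1 :=
  ![1, !![0, 1; 1, 0], !![0, -Complex.I; Complex.I, 0], !![1, 0; 0, -1]]

/-- The Pauli transfer matrix `T_{Q,P} = Tr(Q N(P)) / 2`. -/
def pauliTransfer (N : Op1 →ₗ[ℂ] Op1) : Matrix (Fin 4) (Fin 4) ℂ :=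
  Matrix.of fun Q P => (pauli Q * N (pauli P)).trace / 2

/-- The Pauli transfer matrix of a channel in normal form with parameters `t` and `D`; the
coordinates `0, 1, 2` stand for `X, Y, Z`. -/
def normalTransfer (t D : EuclideanSpace ℝ (Fin 3)) : Matrix (Fin 4) (Fin 4) ℂ :=
  !![1, 0, 0, 0;
     (t 0 : ℂ), (D 0 : ℂ), 0, 0;
     (t 1 : ℂ), 0, (D 1 : ℂ), 0;
     (t 2 : ℂ), 0, 0, (D 2 : ℂ)]

/-- `N` has a normal form with parameters `t` and `D`: up to unitaries before and after, it is a
channel whose Pauli transfer matrix is `normalTransfer t D`. -/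
def HasNormalForm (N : Op1 →ₗ[ℂ] Op1) (t D : EuclideanSpace ℝ (Fin 3)) : Prop :=
  ∃ (W V : U (Fin 2)) (N' : Op1 →ₗ[ℂ] Op1), IsChannel N' ∧
    pauliTransfer N' = normalTransfer t D ∧
    ∀ A : Op1, N A = W.1 * N' (V.1.conjTranspose * A * V.1) * W.1.conjTranspose

/-- The contraction constant `c = (‖t‖² + ‖D‖²) / 3`. -/
def contraction (t D : EuclideanSpace ℝ (Fin 3)) : ℝ :=
  (‖t‖ ^ 2 + ‖D‖ ^ 2) / 3

/-! Operators on `n` qubits -/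

/-- Operators on `n` qubits, in the computational basis. -/
abbrev Op (n : ℕ) : Type := Matrix (Fin n → Fin 2) (Fin n → Fin 2) ℂ

/-- A density matrix. -/
structure IsState {n : ℕ} (ρ : Op n) : Prop where
  posSemidef : ρ.PosSemidef
  trace_eq_one : ρ.trace = 1

/-- The tensor product of single-qubit operators. -/
def tensorOp {n : ℕ} (M : Fin n → Op1) : Op n :=
  Matrix.of fun x y => ∏ k, M k (x k) (y k)

/-- The Pauli operator of `{I, X, Y, Z}^{⊗n}` with the given tensor factors. -/
def pauliString {n : ℕ} (P : Fin n → Fin 4) : Op n :=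
  tensorOp fun k => pauli (P k)

/-- The Pauli weight: the number of tensor factors different from `I`. -/
def pauliWeight {n : ℕ} (P : Fin n → Fin 4) : ℕ :=
  (Finset.univ.filter fun k => P k ≠ 0).card

/-- The layer `N^{⊗n}` of local noise, extended linearly from matrix units. -/
def noiseLayer (n : ℕ) (N : Op1 →ₗ[ℂ] Op1) (A : Op n) : Op n :=
  ∑ i : Fin n → Fin 2, ∑ j : Fin n → Fin 2,
    A i j • tensorOp fun k => N (Matrix.single (i k) (j k) 1)

/-- The two-qubit gate `u` applied to the qubits `a` and `b` (with `a ≠ b`). -/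
def twoQubitGate {n : ℕ} (a b : Fin n) (u : U (Fin 2 × Fin 2)) : Op n :=
  Matrix.of fun x y =>
    if ∀ k, k ≠ a → k ≠ b → x k = y k then u.1 (x a, x b) (y a, y b) else 0

/-! Random circuits -/

/-- A random circuit on `n` qubits with `L` layers of two-qubit gates and a final layer of
single-qubit gates, of arbitrary geometry. In layer `ℓ` the gates `0, 1, …, numGates ℓ - 1` act in
this order, gate `g` on the pair `site ℓ g` of qubits; each qubit is acted on in each layer.
All gates follow 2-design distributions. -/
structure RandomCircuit (n L : ℕ) where
  numGates : Fin L → ℕ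
  site : (ℓ : Fin L) → Fin (numGates ℓ) → Fin n × Fin n
  site_ne : ∀ ℓ g, (site ℓ g).1 ≠ (site ℓ g).2
  covers : ∀ (ℓ : Fin L) (q : Fin n), ∃ g, q = (site ℓ g).1 ∨ q = (site ℓ g).2
  gateLaw : (i : Σ ℓ : Fin L, Fin (numGates ℓ)) → Measure (U (Fin 2 × Fin 2))
  gateLaw_design : ∀ i, IsTwoDesign (gateLaw i)
  finalLaw : Fin n → Measure (U (Fin 2))
  finalLaw_design : ∀ q, IsTwoDesign (finalLaw q)

namespace RandomCircuit

variable {n L : ℕ}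

/-- A choice of all the gates: the two-qubit gates and the final single-qubit gates. -/
abbrev Gates (C : RandomCircuit n L) : Type :=
  ((Σ ℓ : Fin L, Fin (C.numGates ℓ)) → U (Fin 2 × Fin 2)) × (Fin n → U (Fin 2))

/-- The law of the gates: they are independent, each with its own distribution. -/
def law (C : RandomCircuit n L) : Measure C.Gates :=
  (Measure.pi C.gateLaw).prod (Measure.pi C.finalLaw)

/-- The unitary of layer `ℓ`, gate `0` acting first. -/
def layerUnitary (C : RandomCircuit n L) (u : C.Gates) (ℓ : Fin L) : Op n :=
  (List.finRange (C.numGates ℓ)).foldl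
    (fun W g => twoQubitGate (C.site ℓ g).1 (C.site ℓ g).2 (u.1 ⟨ℓ, g⟩) * W) 1

/-- One noisy layer: the unitary layer `ℓ`, followed by noise on every qubit. -/
def noisyLayer (C : RandomCircuit n L) (N : Op1 →ₗ[ℂ] Op1) (u : C.Gates) (ℓ : Fin L)
    (A : Op n) : Op n :=
  noiseLayer n N (C.layerUnitary u ℓ * A * (C.layerUnitary u ℓ).conjTranspose)

/-- The noisy circuit in which only the last `l` noisy layers, and the final layer of
single-qubit gates, are applied (for `l ≤ L`). -/
def lastLayers (C : RandomCircuit n L) (N : Op1 →ₗ[ℂ] Op1) (u : C.Gates) (l : ℕ)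
    (A : Op n) : Op n :=
  tensorOp (fun q => (u.2 q).1) *
    ((List.finRange L).drop (L - l)).foldl (fun B ℓ => C.noisyLayer N u ℓ B) A *
    (tensorOp fun q => (u.2 q).1).conjTranspose

/-- The whole noisy circuit `Φ`. -/
def channel (C : RandomCircuit n L) (N : Op1 →ₗ[ℂ] Op1) (u : C.Gates) (A : Op n) : Op n :=
  C.lastLayers N u L A

end RandomCircuit

end NoisyCircuit

end

open NoisyCircuit

/-! Everything is computed for the second moments m(Q) = E|Tr(Q A)|² of the Pauli coefficients of
the evolving operator A.

In the Pauli basis, conjugation by a gate is a real orthogonal matrix τ fixing the identity. The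
2-design property gives E[τ(q,s) τ(r,t)] = 0 unless q = r and s = t, while E[τ(q,s)²] is uniform
over the non-identity Paulis (`IsPauliFrame.integral_design`). A random gate therefore acts on
second moments by a stochastic matrix, and it leaves coefficients that differ on its qubits
uncorrelated. Since a layer touches every qubit, all distinct coefficients are uncorrelated when the
noise arrives, and the noise acts on m through the squared entries |T(q,r)|² of its transfer matrix
(`pauliMoment_noiseLayer`).

A single row of T need not contract. Averaged over the three non-identity rows, however, the row
sums of |T|² equal c. The quantity propagated is thus the average of m over all strings of a given
support, `supportAvg`. The last noise layer, seen through the final single-qubit gates, contributes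
c^|P| (`supportAvg_noiseStep_le`). The weights produced by an earlier layer of gates depend only on
supports, so a bound on support averages is all that passes through it (`foldl_gateStep_le`). For a
traceless input the identity string carries nothing and every other string has weight at least one,
so each earlier noise layer contributes at least one factor c
(`RandomCircuit.supportAvg_evolve_le`). For the truncated circuit the same bound is applied to the
last l layers acting on the traceless random operator "first layers of ρ₀, minus ρ₀".

That c < 1 is a purity statement: 1 + 3c is the squared Frobenius norm of T, hence of the Choi
matrix J, and Tr J = 2. If c ≥ 1 then J has rank one, so the channel has a single Kraus operator,
which trace preservation makes unitary. The Frobenius norm is invariant under unitaries before and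
after, so every normal form yields the same c. A normal form exists by the singular value
decomposition of the 3 × 3 Bloch block of T. -/

namespace NoisyCircuit

/-! Pauli frames: orthogonal bases of Hermitian unitaries that pairwise commute or anticommute -/

/-- The properties of the Pauli operators on a register that enter the second-moment
calculus; `ac j k` says whether `σ j` and `σ k` anticommute. -/
structure IsPauliFrame {K ι : Type} [Fintype K] [DecidableEq K] [Fintype ι] [DecidableEq ι]
    (σ : K → Matrix ι ι ℂ) (z : K) (ac : K → K → Bool) : Prop where
  card_ne : (Fintype.card ι : ℂ) ≠ 0
  herm : ∀ k, (σ k).conjTranspose = σ k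
  sq : ∀ k, σ k * σ k = 1
  one : σ z = 1
  conj : ∀ w k, σ w * σ k * σ w = (if ac w k then (-1 : ℂ) else 1) • σ k
  trace_mul : ∀ j k, (σ j * σ k).trace = if j = k then (Fintype.card ι : ℂ) else 0
  -- The sum of σ k ⊗ σ k is the dimension times the swap operator; this encodes completeness of the
  -- basis.
  complete : ∀ i j l m, ∑ k, σ k i j * σ k l m =
    if i = m ∧ j = l then (Fintype.card ι : ℂ) else 0
  -- Distinct elements are told apart by a sign under conjugation, which kills off-diagonal moments.
  -- The next field makes any two non-identity elements unitarily conjugate in two steps.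
  sep : ∀ j k, j ≠ k → ∃ w, ac w j ≠ ac w k
  conn : ∀ j k, j ≠ z → k ≠ z → ∃ r, ac j r = true ∧ ac r k = true

/-- Anticommutation of single-qubit Pauli operators. -/
def pauliAC (j k : Fin 4) : Bool := decide (j ≠ 0 ∧ k ≠ 0 ∧ j ≠ k)

/-- The two-qubit Pauli operators. -/
def pauliPair (s : Fin 4 × Fin 4) : Matrix (Fin 2 × Fin 2) (Fin 2 × Fin 2) ℂ :=
  Matrix.kronecker (pauli s.1) (pauli s.2)

/-- Anticommutation of two-qubit Pauli operators. -/
def pauliPairAC (j k : Fin 4 × Fin 4) : Bool :=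
  xor (pauliAC j.1 k.1) (pauliAC j.2 k.2)

/-! ### The frame axioms for one and two qubits -/

theorem pauli_conjTranspose (k : Fin 4) : (pauli k).conjTranspose = pauli k := by
  fin_cases k <;> ext i j <;> fin_cases i <;> fin_cases j <;>
    simp [pauli, Matrix.conjTranspose_apply]

theorem pauli_zero : pauli 0 = 1 := rfl

theorem pauli_mul_self (k : Fin 4) : pauli k * pauli k = 1 := by
  fin_cases k <;> ext i j <;> fin_cases i <;> fin_cases j <;>
    simp [pauli, Matrix.mul_apply]

theorem pauli_conj (w k : Fin 4) :
    pauli w * pauli k * pauli w = (if pauliAC w k then (-1 : ℂ) else 1) • pauli k := by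
  fin_cases w <;> fin_cases k <;> ext i j <;> fin_cases i <;> fin_cases j <;>
    simp [pauli, pauliAC, Matrix.mul_apply]

theorem pauli_trace_mul (j k : Fin 4) :
    (pauli j * pauli k).trace = if j = k then 2 else 0 := by
  fin_cases j <;> fin_cases k <;>
    simp [pauli, Matrix.trace] <;> norm_num

theorem pauli_complete (i j l m : Fin 2) :
    ∑ k, pauli k i j * pauli k l m = if i = m ∧ j = l then 2 else 0 := by
  fin_cases i <;> fin_cases j <;> fin_cases l <;> fin_cases m <;>
    simp [pauli, Fin.sum_univ_four] <;> norm_num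

theorem isPauliFrame_pauli : IsPauliFrame pauli 0 pauliAC where
  card_ne := by simp
  herm := pauli_conjTranspose
  sq := pauli_mul_self
  one := rfl
  conj := pauli_conj
  trace_mul := by simpa using pauli_trace_mul
  complete := by simpa using pauli_complete
  sep := by decide
  conn := by decide

theorem isPauliFrame_pauliPair : IsPauliFrame pauliPair (0, 0) pauliPairAC where
  card_ne := by simp
  herm k := by
    simp [pauliPair, Matrix.conjTranspose_kronecker, pauli_conjTranspose]
  sq k := by
    simp only [pauliPair, Matrix.kronecker, ← Matrix.mul_kronecker_mul, pauli_mul_self, Matrix.one_kronecker_one]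
  one := by simp [pauliPair, pauli_zero]
  conj w k := by
    simp only [pauliPair, Matrix.kronecker, ← Matrix.mul_kronecker_mul, pauli_conj, pauliPairAC]
    rw [Matrix.smul_kronecker, Matrix.kronecker_smul, smul_smul]
    congr 1
    by_cases h1 : pauliAC w.1 k.1 = true <;> by_cases h2 : pauliAC w.2 k.2 = true <;> simp [h1, h2]
  trace_mul j k := by
    simp only [pauliPair, Matrix.kronecker, ← Matrix.mul_kronecker_mul, Matrix.trace_kronecker, pauli_trace_mul,
      Prod.ext_iff]
    by_cases h1 : j.1 = k.1 <;> by_cases h2 : j.2 = k.2 <;> (simp [h1, h2]; try norm_num)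
  complete i j l m := by
    rw [Fintype.sum_prod_type]
    simp only [pauliPair, Matrix.kronecker, Matrix.kroneckerMap_apply]
    have h : ∀ a b, pauli a i.1 j.1 * pauli b i.2 j.2 * (pauli a l.1 m.1 * pauli b l.2 m.2) =
        (pauli a i.1 j.1 * pauli a l.1 m.1) * (pauli b i.2 j.2 * pauli b l.2 m.2) := by
      intros; ring
    simp only [h, ← Finset.mul_sum, ← Finset.sum_mul, pauli_complete, Prod.ext_iff]
    by_cases h1 : i.1 = m.1 <;> by_cases h2 : i.2 = m.2 <;> by_cases h3 : j.1 = l.1 <;>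
      by_cases h4 : j.2 = l.2 <;> (simp [h1, h2, h3, h4]; try norm_num)
  sep := by decide +kernel
  conn := by decide +kernel

/-! ### Transfer matrices of unitary conjugation -/

/-- The matrix of `A ↦ u A u†` in the basis `σ`. -/
noncomputable def frameTransfer {K ι : Type} [Fintype ι] (σ : K → Matrix ι ι ℂ)
    (u : Matrix ι ι ℂ) (q s : K) : ℂ :=
  (σ q * (u * σ s * u.conjTranspose)).trace / Fintype.card ι

/-- By cyclicity a left factor of the gate moves onto the observable, which is how left invariance
of Haar measure is exploited. -/
theorem frameTransfer_mul_left {K ι : Type} [Fintype ι] (σ : K → Matrix ι ι ℂ) (u w : Matrix ι ι ℂ) (q s : K) :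
    frameTransfer σ (w * u) q s =
      ((w.conjTranspose * σ q * w) * (u * σ s * u.conjTranspose)).trace / Fintype.card ι := by
  unfold frameTransfer
  congr 1
  rw [Matrix.conjTranspose_mul]
  calc (σ q * (w * u * σ s * (u.conjTranspose * w.conjTranspose))).trace
      = ((σ q * w * (u * σ s * u.conjTranspose)) * w.conjTranspose).trace := by
        simp only [mul_assoc]
    _ = _ := by rw [Matrix.trace_mul_comm]; simp only [mul_assoc]

namespace IsPauliFrame

variable {K ι : Type} [Fintype K] [DecidableEq K] [Fintype ι] [DecidableEq ι]
  {σ : K → Matrix ι ι ℂ} {z : K} {ac : K → K → Bool}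

theorem expansion (h : IsPauliFrame σ z ac) (A : Matrix ι ι ℂ) :
    ∑ k, ((σ k * A).trace / Fintype.card ι) • σ k = A := by
  ext l m
  rw [Matrix.sum_apply]
  have hc := h.card_ne
  have : ∀ k, (((σ k * A).trace / Fintype.card ι) • σ k) l m =
      ∑ i, ∑ j, (A j i / Fintype.card ι) * (σ k i j * σ k l m) := by
    intro k
    simp only [Matrix.smul_apply, Matrix.trace, Matrix.diag, Matrix.mul_apply, smul_eq_mul,
      Finset.sum_mul, Finset.sum_div]
    refine Finset.sum_congr rfl fun i _ => Finset.sum_congr rfl fun j _ => ?_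
    ring
  simp only [this]
  rw [Finset.sum_comm]
  simp_rw [Finset.sum_comm (s := (Finset.univ : Finset K)), ← Finset.mul_sum, h.complete]
  rw [Finset.sum_eq_single m, Finset.sum_eq_single l]
  · simp only [and_self, if_true]
    field_simp
  · intro b _ hb; simp [hb]
  · simp
  · intro b _ hb; simp [hb]
  · simp

/-- Parseval's identity for the trace pairing in the basis σ. -/
theorem sum_trace_mul_trace (h : IsPauliFrame σ z ac) (A B : Matrix ι ι ℂ) :
    ∑ k, (σ k * A).trace * (σ k * B).trace = Fintype.card ι * (A * B).trace := by
  conv_rhs => rw [← h.expansion A]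
  have hc := h.card_ne
  rw [Finset.sum_mul, Matrix.trace_sum, Finset.mul_sum]
  refine Finset.sum_congr rfl fun k _ => ?_
  rw [Matrix.smul_mul, Matrix.trace_smul, smul_eq_mul]
  field_simp

theorem trace_eq (h : IsPauliFrame σ z ac) (k : K) :
    (σ k).trace = if k = z then (Fintype.card ι : ℂ) else 0 := by
  have := h.trace_mul k z
  rwa [h.one, mul_one] at this

/-- Reality of the transfer matrix lets E[τ τ] stand for E[τ τ̄] in all second moments below. -/
theorem star_frameTransfer (h : IsPauliFrame σ z ac) (u : Matrix ι ι ℂ) (q s : K) :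
    star (frameTransfer σ u q s) = frameTransfer σ u q s := by
  unfold frameTransfer
  rw [star_div₀, ← Matrix.trace_conjTranspose]
  simp only [Matrix.conjTranspose_mul, Matrix.conjTranspose_conjTranspose, h.herm]
  rw [Matrix.trace_mul_comm]
  simp [mul_assoc]

theorem conj_eq_sum (h : IsPauliFrame σ z ac) (u : Matrix ι ι ℂ) (q : K) :
    u.conjTranspose * σ q * u = ∑ s, frameTransfer σ u q s • σ s := by
  rw [← h.expansion (u.conjTranspose * σ q * u)]
  refine Finset.sum_congr rfl fun s _ => ?_
  congr 2
  rw [Matrix.trace_mul_comm (σ q), Matrix.trace_mul_comm (σ s)]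
  simp only [mul_assoc]
  rw [Matrix.trace_mul_comm]
  simp only [mul_assoc]
  rw [Matrix.trace_mul_comm]
  simp only [mul_assoc]

/-- Conjugation by a unitary preserves the trace pairing, so its matrix in an orthogonal basis has
orthonormal columns. -/
theorem sum_frameTransfer_mul (h : IsPauliFrame σ z ac) {u : Matrix ι ι ℂ}
    (hu : u.conjTranspose * u = 1) (s t : K) :
    ∑ q, frameTransfer σ u q s * frameTransfer σ u q t = if s = t then 1 else 0 := by
  have hc := h.card_ne
  have h1 : ∀ q, frameTransfer σ u q s * frameTransfer σ u q t =
      ((σ q * (u * σ s * u.conjTranspose)).trace * (σ q * (u * σ t * u.conjTranspose)).trace) *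
        (1 / ((Fintype.card ι : ℂ) * Fintype.card ι)) := by
    intro q; unfold frameTransfer; field_simp
  simp only [h1]
  rw [← Finset.sum_mul, h.sum_trace_mul_trace]
  have h2 : u * σ s * u.conjTranspose * (u * σ t * u.conjTranspose) =
      u * (σ s * σ t * u.conjTranspose) := by
    calc _ = u * σ s * (u.conjTranspose * u) * σ t * u.conjTranspose := by
            simp only [mul_assoc]
      _ = _ := by rw [hu]; simp only [mul_assoc, mul_one]
  rw [h2, Matrix.trace_mul_comm, mul_assoc (σ s * σ t), hu, mul_one, h.trace_mul]
  split_ifs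
  · field_simp
  · simp

theorem frameTransfer_left_zero (h : IsPauliFrame σ z ac) {u : Matrix ι ι ℂ}
    (hu : u.conjTranspose * u = 1) (s : K) :
    frameTransfer σ u z s = if s = z then 1 else 0 := by
  have hc := h.card_ne
  unfold frameTransfer
  rw [h.one, one_mul, Matrix.trace_mul_comm, ← mul_assoc, hu, one_mul, h.trace_eq]
  split_ifs
  · field_simp
  · simp

theorem frameTransfer_right_zero (h : IsPauliFrame σ z ac) {u : Matrix ι ι ℂ}
    (hu : u * u.conjTranspose = 1) (q : K) :
    frameTransfer σ u q z = if q = z then 1 else 0 := by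
  have hc := h.card_ne
  unfold frameTransfer
  rw [h.one, mul_one, hu, mul_one, h.trace_eq]
  split_ifs
  · field_simp
  · simp

/-- Two anticommuting elements of a frame are unitarily conjugate. -/
theorem exists_conj_of_anticomm (h : IsPauliFrame σ z ac) {j k : K} (hjk : ac j k = true) :
    ∃ w : U ι, w.1.conjTranspose * σ j * w.1 = σ k := by
  have h1 : σ j * σ k * σ j = -σ k := by simpa [hjk] using h.conj j k
  have h2 : σ k * σ j = -(σ j * σ k) := by
    calc σ k * σ j = σ j * σ j * σ k * σ j := by rw [h.sq, one_mul]
      _ = σ j * (σ j * σ k * σ j) := by simp only [mul_assoc]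
      _ = _ := by rw [h1, mul_neg]
  have hr : ((Real.sqrt 2 : ℝ) : ℂ)⁻¹ * ((Real.sqrt 2 : ℝ) : ℂ)⁻¹ = 1 / 2 := by
    rw [← mul_inv, ← Complex.ofReal_mul, Real.mul_self_sqrt (by norm_num)]; norm_num
  set r : ℂ := ((Real.sqrt 2 : ℝ) : ℂ)⁻¹ with hrdef
  have hstar : star r = r := by simp [hrdef]
  have hwH : (r • (σ j + σ k)).conjTranspose = r • (σ j + σ k) := by
    rw [Matrix.conjTranspose_smul, Matrix.conjTranspose_add, h.herm, h.herm, hstar]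
  have hww : (r • (σ j + σ k)) * (r • (σ j + σ k)) = 1 := by
    rw [Matrix.smul_mul, Matrix.mul_smul, smul_smul, hr]
    rw [mul_add, add_mul, add_mul, h.sq, h.sq, h2]
    rw [show (1 : Matrix ι ι ℂ) + -(σ j * σ k) + (σ j * σ k + 1) = (2 : ℂ) • 1 by
      rw [two_smul]; abel, smul_smul]
    norm_num
  -- The Hadamard-type reflection (σ j + σ k)/√2: it squares to one because the cross terms cancel,
  -- and it exchanges σ j and σ k.
  refine ⟨⟨r • (σ j + σ k), ?_⟩, ?_⟩
  · rw [Matrix.mem_unitaryGroup_iff, Matrix.star_eq_conjTranspose, hwH, hww]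
  · change (r • (σ j + σ k)).conjTranspose * σ j * (r • (σ j + σ k)) = σ k
    rw [hwH, Matrix.smul_mul, Matrix.smul_mul, Matrix.mul_smul, smul_smul, hr]
    rw [add_mul, mul_add, add_mul, add_mul, h.sq, h2, one_mul, one_mul, neg_mul, neg_mul, h1, mul_assoc, h.sq, mul_one]
    rw [show σ j + - -σ k + (σ k + -σ j) = (2 : ℂ) • σ k by rw [two_smul]; abel, smul_smul]
    norm_num

/-- Even commuting elements are conjugate: pass through a third element that anticommutes with both.
-/
theorem exists_conj (h : IsPauliFrame σ z ac) {j k : K} (hj : j ≠ z) (hk : k ≠ z) :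
    ∃ w : U ι, w.1.conjTranspose * σ j * w.1 = σ k := by
  obtain ⟨r, h1, h2⟩ := h.conn j k hj hk
  obtain ⟨v, hv⟩ := h.exists_conj_of_anticomm h1
  obtain ⟨w, hw⟩ := h.exists_conj_of_anticomm h2
  refine ⟨v * w, ?_⟩
  rw [← hw, ← hv]
  simp [Matrix.conjTranspose_mul, mul_assoc]

end IsPauliFrame

/-! Second moments of unitary 2-designs in a Pauli frame -/

section Topology

variable (ι : Type) [Fintype ι] [DecidableEq ι]

instance instSecondCountableTopologyU : SecondCountableTopology (U ι) :=
  haveI : SecondCountableTopology (Matrix ι ι ℂ) :=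
    inferInstanceAs (SecondCountableTopology (ι → ι → ℂ))
  TopologicalSpace.Subtype.secondCountableTopology _

instance instIsProbabilityMeasureHaarU : IsProbabilityMeasure (haarU ι) where
  measure_univ := by
    have := Measure.haarMeasure_self (K₀ := (⊤ : TopologicalSpace.PositiveCompacts (U ι)))
    simpa [haarU] using this

instance instIsMulLeftInvariantHaarU : (haarU ι).IsMulLeftInvariant := by
  unfold haarU; infer_instance

end Topology

/-- Continuous functions on a compact space are integrable for finite measures. -/
theorem _root_.Continuous.integrable_of_compactSpace {X E : Type*} [TopologicalSpace X]
    [CompactSpace X]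
    [MeasurableSpace X] [OpensMeasurableSpace X] [NormedAddCommGroup E]
    [SecondCountableTopologyEither X E]
    {μ : Measure X} [IsFiniteMeasure μ] {f : X → E} (hf : Continuous f) : Integrable f μ := by
  rw [← integrableOn_univ]
  exact hf.continuousOn.integrableOn_compact' isCompact_univ MeasurableSet.univ

section Moments

@[fun_prop]
theorem continuous_frameTransfer {K ι : Type} [Fintype ι]
    {σ : K → Matrix ι ι ℂ} {X : Type*} [TopologicalSpace X] {f : X → Matrix ι ι ℂ}
    (hf : Continuous f) (q s : K) : Continuous fun x => frameTransfer σ (f x) q s := by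
  unfold frameTransfer
  fun_prop

/-- A product of two transfer entries is a linear functional of (u ⊗ u) O (u ⊗ u)† with O = σ s ⊗ σ
t, so its mean depends on the law only through `secondMoment`. This is what reduces 2-designs to
Haar measure. -/
theorem integral_frameTransfer_mul_eq {K ι : Type} [Fintype ι] [DecidableEq ι]
    {σ : K → Matrix ι ι ℂ} (ν : Measure (U ι)) [IsProbabilityMeasure ν]
    (q s r t : K) :
    ∫ u : U ι, frameTransfer σ u.1 q s * frameTransfer σ u.1 r t ∂ν =
      (Matrix.kronecker (σ q) (σ r) * secondMoment ν (Matrix.kronecker (σ s) (σ t))).trace /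
        (Fintype.card ι * Fintype.card ι) := by
  have h : ∀ u : U ι, frameTransfer σ u.1 q s * frameTransfer σ u.1 r t =
      (∑ i, ∑ j, Matrix.kronecker (σ q) (σ r) i j * (Matrix.kronecker u.1 u.1 *
        Matrix.kronecker (σ s) (σ t) * (Matrix.kronecker u.1 u.1).conjTranspose) j i) /
          (Fintype.card ι * Fintype.card ι) := by
    intro u
    unfold frameTransfer
    rw [div_mul_div_comm, ← Matrix.trace_kronecker, Matrix.mul_kronecker_mul,
      Matrix.mul_kronecker_mul, Matrix.mul_kronecker_mul, ← Matrix.conjTranspose_kronecker]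
    rfl
  have hc : ∀ i j, Continuous fun u : U ι => (Matrix.kronecker u.1 u.1 *
        Matrix.kronecker (σ s) (σ t) * (Matrix.kronecker u.1 u.1).conjTranspose) j i := by
    intro i j
    have h1 : Continuous fun u : U ι => Matrix.kronecker u.1 u.1 := by
      refine continuous_matrix fun a b => ?_
      simp only [Matrix.kronecker, Matrix.kroneckerMap_apply]
      exact (continuous_subtype_val.matrix_elem _ _).mul (continuous_subtype_val.matrix_elem _ _)
    fun_prop
  simp only [h]
  rw [integral_div, integral_finsetSum]
  · congr 1
    refine Finset.sum_congr rfl fun i _ => ?_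
    rw [integral_finsetSum, Matrix.diag_apply, Matrix.mul_apply]
    · refine Finset.sum_congr rfl fun j _ => ?_
      rw [integral_const_mul]
      rfl
    · intro j _
      exact ((hc i j).const_mul _).integrable_of_compactSpace
  · intro i _
    exact (continuous_finsetSum _ fun j _ => (hc i j).const_mul _).integrable_of_compactSpace

variable {K ι : Type} [Fintype K] [DecidableEq K] [Fintype ι] [DecidableEq ι]
  {σ : K → Matrix ι ι ℂ} {z : K} {ac : K → K → Bool}

/-- The second moment `E[τ(q, s) ^ 2]` of the transfer matrix of a random gate. -/
noncomputable def frameWeight (z q s : K) : ℝ :=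
  if q = z then if s = z then 1 else 0
  else if s = z then 0 else 1 / ((Fintype.card K : ℝ) - 1)

theorem _root_.Matrix.unitary_conjTranspose_mul (u : U ι) : u.1.conjTranspose * u.1 = 1 := by
  rw [← Matrix.star_eq_conjTranspose]; exact Matrix.UnitaryGroup.star_mul_self u

theorem _root_.Matrix.unitary_mul_conjTranspose (u : U ι) : u.1 * u.1.conjTranspose = 1 :=
  Matrix.mem_unitaryGroup_iff.mp u.2

/-- Left invariance does everything. Multiplying the gate by a frame element changes signs and kills
q ≠ r; multiplying by unitaries that permute the non-identity elements makes the diagonal value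
independent of q; orthonormality of columns then fixes that value. -/
theorem IsPauliFrame.integral_haar (h : IsPauliFrame σ z ac) (q s r t : K) :
    ∫ u : U ι, frameTransfer σ u.1 q s * frameTransfer σ u.1 r t ∂haarU ι =
      if q = r ∧ s = t then (frameWeight z q s : ℂ) else 0 := by
  have inv : ∀ (w : U ι) (q s r t : K), ∫ u : U ι, frameTransfer σ (w.1 * u.1) q s * frameTransfer σ (w.1 * u.1) r t
      ∂haarU ι = ∫ u : U ι, frameTransfer σ u.1 q s * frameTransfer σ u.1 r t ∂haarU ι := by
    intro w q s r t
    exact integral_mul_left_eq_self (μ := haarU ι)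
      (fun u : U ι => frameTransfer σ u.1 q s * frameTransfer σ u.1 r t) w
  by_cases hqr : q = r
  swap
  · rw [if_neg (fun hh => hqr hh.1)]
    -- σ w flips the sign of exactly one of the two factors, so the integral equals its own
    -- negative.
    obtain ⟨w, hw⟩ := h.sep q r hqr
    have hwU : σ w ∈ Matrix.unitaryGroup ι ℂ := by
      rw [Matrix.mem_unitaryGroup_iff, Matrix.star_eq_conjTranspose, h.herm, h.sq]
    have hi := inv ⟨σ w, hwU⟩ q s r t
    have key : ∀ (u : U ι) k v, frameTransfer σ (σ w * u.1) k v =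
        (if ac w k then (-1 : ℂ) else 1) * frameTransfer σ u.1 k v := by
      intro u k v
      rw [frameTransfer_mul_left, h.herm, h.conj, Matrix.smul_mul, Matrix.trace_smul,
        smul_eq_mul, mul_div_assoc]
      rfl
    have hsign : (if ac w q then (-1 : ℂ) else 1) * (if ac w r then (-1 : ℂ) else 1) = -1 := by
      by_cases h1 : ac w q = true <;> by_cases h2 : ac w r = true <;> simp_all
    simp only [key] at hi
    rw [show (fun u : U ι => (if ac w q then (-1 : ℂ) else 1) * frameTransfer σ u.1 q s *
      ((if ac w r then (-1 : ℂ) else 1) * frameTransfer σ u.1 r t)) =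
      fun u : U ι => -(frameTransfer σ u.1 q s * frameTransfer σ u.1 r t) by
        funext u
        rw [mul_mul_mul_comm, hsign, neg_one_mul], integral_neg] at hi
    exact self_eq_neg.mp hi.symm
  subst hqr
  have hR := fun (u : U ι) q => h.frameTransfer_right_zero (Matrix.unitary_mul_conjTranspose u) q
  have hL := fun (u : U ι) s => h.frameTransfer_left_zero (Matrix.unitary_conjTranspose_mul u) s
  by_cases hq : q = z
  · subst hq
    simp only [hL, frameWeight, true_and, if_true, integral_const, probReal_univ, one_smul]
    by_cases h1 : s = q <;> by_cases h2 : t = q <;> simp [h1, h2]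
    · rw [eq_comm] at h2; simp [h2]
  · by_cases hs : s = z
    · simp only [hs, hR, hq, frameWeight]
      simp
    by_cases ht : t = z
    · simp only [ht, hR, hq, frameWeight]
      simp [hs]
    have hconst : ∀ p, p ≠ z → ∫ u : U ι, frameTransfer σ u.1 p s * frameTransfer σ u.1 p t
        ∂haarU ι = ∫ u : U ι, frameTransfer σ u.1 q s * frameTransfer σ u.1 q t ∂haarU ι := by
      intro p hp
      obtain ⟨w, hw⟩ := h.exists_conj hp hq
      rw [← inv w]
      simp only [frameTransfer_mul_left, hw]
      rfl
    have hsum : ∑ p, ∫ u : U ι, frameTransfer σ u.1 p s * frameTransfer σ u.1 p t ∂haarU ι =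
        if s = t then 1 else 0 := by
      rw [← integral_finsetSum]
      · simp only [h.sum_frameTransfer_mul (Matrix.unitary_conjTranspose_mul _), integral_const,
          probReal_univ, one_smul]
      · intro p _
        refine Continuous.integrable_of_compactSpace ?_
        fun_prop
    have hz : ∫ u : U ι, frameTransfer σ u.1 z s * frameTransfer σ u.1 z t ∂haarU ι = 0 := by
      simp [hL, hs]
    -- The row z contributes nothing and the other |K| − 1 rows contribute equally, whence the
    -- weight 1/(|K| − 1).
    rw [← Finset.add_sum_erase _ _ (Finset.mem_univ z), hz, zero_add,
      Finset.sum_congr rfl (fun p hp => hconst p (Finset.ne_of_mem_erase hp)),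
      Finset.sum_const, Finset.card_erase_of_mem (Finset.mem_univ z), Finset.card_univ,
      nsmul_eq_mul] at hsum
    have hcard : 1 < Fintype.card K := Fintype.one_lt_card_iff.mpr ⟨q, z, hq⟩
    have hne : (Fintype.card K : ℂ) - 1 ≠ 0 := by
      rw [sub_ne_zero]; exact_mod_cast hcard.ne'
    rw [Nat.cast_sub hcard.le, Nat.cast_one] at hsum
    simp only [true_and, frameWeight, hq, hs, if_false]
    push_cast
    rw [eq_comm, ← mul_right_inj' hne, hsum]
    split_ifs
    · field_simp
    · simp

/-- Second moments of a unitary 2-design. -/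
theorem IsPauliFrame.integral_design (h : IsPauliFrame σ z ac) {ν : Measure (U ι)}
    (hν : IsTwoDesign ν) (q s r t : K) :
    ∫ u : U ι, frameTransfer σ u.1 q s * frameTransfer σ u.1 r t ∂ν =
      if q = r ∧ s = t then (frameWeight z q s : ℂ) else 0 := by
  have := hν.isProb
  rw [← h.integral_haar, integral_frameTransfer_mul_eq, integral_frameTransfer_mul_eq, hν.moment]

theorem frameWeight_nonneg (z q s : K) : 0 ≤ frameWeight z q s := by
  unfold frameWeight
  have : 1 ≤ (Fintype.card K : ℝ) := by
    have : Nonempty K := ⟨z⟩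
    exact_mod_cast Fintype.card_pos
  split_ifs
  · exact zero_le_one
  · exact le_rfl
  · exact le_rfl
  · exact one_div_nonneg.mpr (by linarith)

theorem frameWeight_comm (z q s : K) : frameWeight z q s = frameWeight z s q := by
  unfold frameWeight
  split_ifs <;> rfl

/-- Column sums of squared transfer entries are one; together with `frameWeight_comm` this makes the
weights doubly stochastic. -/
theorem sum_frameWeight (z q : K) : ∑ s, frameWeight z q s = 1 := by
  by_cases hq : q = z
  · simp [frameWeight, hq]
  · rw [← Finset.add_sum_erase _ _ (Finset.mem_univ z)]
    have : ∀ s ∈ Finset.univ.erase z, frameWeight z q s = 1 / ((Fintype.card K : ℝ) - 1) := by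
      intro s hs
      simp [frameWeight, hq, Finset.ne_of_mem_erase hs]
    rw [Finset.sum_congr rfl this]
    have hcard : 1 < Fintype.card K := Fintype.one_lt_card_iff.mpr ⟨q, z, hq⟩
    have hne : (Fintype.card K : ℝ) - 1 ≠ 0 := by
      rw [sub_ne_zero]; exact_mod_cast hcard.ne'
    simp [frameWeight, hq, Nat.cast_sub hcard.le, hne]

end Moments

section

/-! Gates and noise in the Pauli basis of `n` qubits -/

theorem prod_sum_eq_sum_prod {n : ℕ} {κ : Type} [Fintype κ] {R : Type*} [CommSemiring R]
    (f : Fin n → κ → R) : ∏ k, ∑ s, f k s = ∑ Q : Fin n → κ, ∏ k, f k (Q k) := by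
  rw [Finset.prod_univ_sum, Fintype.piFinset_univ]

variable {n : ℕ}

theorem tensorOp_mul (M M' : Fin n → Op1) :
    tensorOp M * tensorOp M' = tensorOp fun k => M k * M' k := by
  ext x y
  simp only [tensorOp, Matrix.mul_apply, Matrix.of_apply, prod_sum_eq_sum_prod,
    Finset.prod_mul_distrib]

theorem conjTranspose_tensorOp (M : Fin n → Op1) :
    (tensorOp M).conjTranspose = tensorOp fun k => (M k).conjTranspose := by
  ext x y
  simp [tensorOp, Matrix.conjTranspose_apply]

theorem trace_tensorOp (M : Fin n → Op1) : (tensorOp M).trace = ∏ k, (M k).trace := by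
  simp only [tensorOp, Matrix.trace, Matrix.diag, Matrix.of_apply, prod_sum_eq_sum_prod]

theorem tensorOp_sum {κ : Type} [Fintype κ] (c : Fin n → κ → ℂ) (M : κ → Op1) :
    (tensorOp fun k => ∑ s, c k s • M s) =
      ∑ Q : Fin n → κ, (∏ k, c k (Q k)) • tensorOp fun k => M (Q k) := by
  ext x y
  simp only [tensorOp, Matrix.of_apply, Matrix.sum_apply, Matrix.smul_apply, smul_eq_mul,
    prod_sum_eq_sum_prod, Finset.prod_mul_distrib]

theorem tensorOp_one : (tensorOp fun _ : Fin n => (1 : Op1)) = 1 := by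
  ext x y
  simp only [tensorOp, Matrix.of_apply, Matrix.one_apply]
  rw [Finset.prod_ite_zero]
  simp [funext_iff]

theorem pauliString_zero : pauliString (0 : Fin n → Fin 4) = 1 := by
  rw [← tensorOp_one]; rfl

theorem conjTranspose_pauliString (Q : Fin n → Fin 4) :
    (pauliString Q).conjTranspose = pauliString Q := by
  simp only [pauliString, conjTranspose_tensorOp, pauli_conjTranspose]

theorem pauliString_mul_self (Q : Fin n → Fin 4) : pauliString Q * pauliString Q = 1 := by
  simp only [pauliString, tensorOp_mul, pauli_mul_self, tensorOp_one]

/-- The Pauli coefficient `Tr(Q A)`. -/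
noncomputable def pauliCoeff (Q : Fin n → Fin 4) (A : Op n) : ℂ := (pauliString Q * A).trace

theorem pauliCoeff_sub (Q : Fin n → Fin 4) (A B : Op n) :
    pauliCoeff Q (A - B) = pauliCoeff Q A - pauliCoeff Q B := by
  simp [pauliCoeff, mul_sub]

theorem pauliCoeff_zero (A : Op n) : pauliCoeff 0 A = A.trace := by
  simp [pauliCoeff, pauliString_zero]

@[fun_prop]
theorem continuous_pauliCoeff {X : Type*} [TopologicalSpace X] {f : X → Op n}
    (hf : Continuous f) (Q : Fin n → Fin 4) : Continuous fun x => pauliCoeff Q (f x) := by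
  unfold pauliCoeff
  fun_prop

theorem trace_tensorOp_mul (M : Fin n → Op1) (A : Op n) :
    (tensorOp M * A).trace = ∑ x, ∑ y, A x y * ∏ k, M k (y k) (x k) := by
  simp only [Matrix.trace, Matrix.diag, Matrix.mul_apply, tensorOp, Matrix.of_apply]
  rw [Finset.sum_comm]
  simp only [mul_comm]

theorem trace_pauli_mul_channel_single (N : Op1 →ₗ[ℂ] Op1) (q : Fin 4) (i j : Fin 2) :
    (pauli q * N (Matrix.single i j 1)).trace = ∑ s, pauliTransfer N q s * pauli s j i := by
  conv_lhs => rw [← isPauliFrame_pauli.expansion (Matrix.single i j (1 : ℂ))]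
  rw [map_sum, Finset.mul_sum, Matrix.trace_sum]
  refine Finset.sum_congr rfl fun s _ => ?_
  rw [map_smul, Matrix.mul_smul, Matrix.trace_smul, Matrix.trace_mul_single]
  simp [pauliTransfer]
  ring

/-- Expanding each matrix unit in Paulis turns the definition of the noise layer by matrix units
into the tensor power of the one-qubit transfer matrix. -/
theorem pauliCoeff_noiseLayer (N : Op1 →ₗ[ℂ] Op1) (Q : Fin n → Fin 4) (A : Op n) :
    pauliCoeff Q (noiseLayer n N A) =
      ∑ R : Fin n → Fin 4, (∏ k, pauliTransfer N (Q k) (R k)) * pauliCoeff R A := by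
  have h1 : ∀ i j : Fin n → Fin 2,
      (pauliString Q * tensorOp fun k => N (Matrix.single (i k) (j k) 1)).trace =
      ∑ R : Fin n → Fin 4, (∏ k, pauliTransfer N (Q k) (R k)) * ∏ k, pauli (R k) (j k) (i k) := by
    intro i j
    rw [pauliString, tensorOp_mul, trace_tensorOp]
    simp only [trace_pauli_mul_channel_single, prod_sum_eq_sum_prod, Finset.prod_mul_distrib]
  simp only [pauliCoeff, noiseLayer, Finset.mul_sum, Matrix.trace_sum, Matrix.mul_smul,
    Matrix.trace_smul, h1, smul_eq_mul]
  conv_rhs =>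
    enter [2, R]
    rw [pauliString, trace_tensorOp_mul]
    simp only [Finset.mul_sum]
  rw [Finset.sum_comm' (t' := Finset.univ) (s' := fun _ => Finset.univ) (by simp)]
  rw [Finset.sum_comm]
  simp_rw [Finset.sum_comm (s := (Finset.univ : Finset (Fin n → Fin 4)))]
  refine Finset.sum_congr rfl fun i _ => Finset.sum_congr rfl fun j _ =>
    Finset.sum_congr rfl fun R _ => ?_
  ring

theorem pauliCoeff_tensorOp_conj (v : Fin n → Op1) (Q : Fin n → Fin 4) (A : Op n) :
    pauliCoeff Q (tensorOp v * A * (tensorOp v).conjTranspose) =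
      ∑ R : Fin n → Fin 4, (∏ k, frameTransfer pauli (v k) (Q k) (R k)) * pauliCoeff R A := by
  have h1 : pauliCoeff Q (tensorOp v * A * (tensorOp v).conjTranspose) =
      (((tensorOp v).conjTranspose * pauliString Q * tensorOp v) * A).trace := by
    rw [pauliCoeff, ← mul_assoc, Matrix.trace_mul_comm]
    simp only [mul_assoc]
  rw [h1, pauliString, conjTranspose_tensorOp, tensorOp_mul, tensorOp_mul]
  simp only [isPauliFrame_pauli.conj_eq_sum]
  rw [tensorOp_sum, Finset.sum_mul, Matrix.trace_sum]
  simp only [Matrix.smul_mul, Matrix.trace_smul, smul_eq_mul]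
  rfl

/-! ### Two-qubit gates on the register -/

/-- `Q` with the letters at `a` and `b` replaced by `s`. -/
def setPair {κ : Type} (Q : Fin n → κ) (a b : Fin n) (s : κ × κ) : Fin n → κ :=
  Function.update (Function.update Q a s.1) b s.2

theorem setPair_left {κ : Type} (Q : Fin n → κ) {a b : Fin n} (hab : a ≠ b) (s : κ × κ) :
    setPair Q a b s a = s.1 := by
  simp [setPair, hab]

theorem setPair_right {κ : Type} (Q : Fin n → κ) (a b : Fin n) (s : κ × κ) :
    setPair Q a b s b = s.2 := by
  simp [setPair]

theorem setPair_of_ne {κ : Type} (Q : Fin n → κ) {a b k : Fin n} (s : κ × κ) (ha : k ≠ a)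
    (hb : k ≠ b) : setPair Q a b s k = Q k := by
  simp [setPair, ha, hb]

/-- A column of a two-qubit gate is supported on indices that agree with the column index off the
pair, so products with a gate collapse to sums over the four values on the pair. -/
theorem sum_agree_off_pair {a b : Fin n} (hab : a ≠ b) (y : Fin n → Fin 2)
    (f : Fin 2 × Fin 2 → ℂ) :
    ∑ x : Fin n → Fin 2, (if ∀ k, k ≠ a → k ≠ b → x k = y k then f (x a, x b) else 0) =
      ∑ p, f p := by
  rw [← Finset.sum_filter]
  refine Finset.sum_nbij' (fun x => (x a, x b)) (fun p => setPair y a b p) ?_ ?_ ?_ ?_ ?_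
  · simp
  · intro p _
    simp only [Finset.mem_filter, Finset.mem_univ, true_and]
    intro k ha hb
    exact setPair_of_ne y p ha hb
  · intro x hx
    simp only [Finset.mem_filter, Finset.mem_univ, true_and] at hx
    funext k
    by_cases hkb : k = b
    · subst hkb; exact setPair_right _ _ _ _
    by_cases hka : k = a
    · subst hka; exact setPair_left _ hab _
    · rw [setPair_of_ne _ _ hka hkb, hx k hka hkb]
  · intro p _
    rw [setPair_left _ hab, setPair_right]
  · intro x _; rfl

/-- The operator with factor `X` on the pair `a, b` and the Pauli letters of `Q` elsewhere. -/
noncomputable def pairOp (a b : Fin n) (Q : Fin n → Fin 4)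
    (X : Matrix (Fin 2 × Fin 2) (Fin 2 × Fin 2) ℂ) : Op n :=
  Matrix.of fun x y => X (x a, x b) (y a, y b) *
    ∏ k ∈ (Finset.univ.erase a).erase b, pauli (Q k) (x k) (y k)

theorem pairOp_pauliPair {a b : Fin n} (hab : a ≠ b) (Q : Fin n → Fin 4) (s : Fin 4 × Fin 4) :
    pairOp a b Q (pauliPair s) = pauliString (setPair Q a b s) := by
  ext x y
  simp only [pairOp, pauliString, tensorOp, Matrix.of_apply, pauliPair, Matrix.kronecker,
    Matrix.kroneckerMap_apply]
  rw [← Finset.mul_prod_erase _ _ (Finset.mem_univ a),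
    ← Finset.mul_prod_erase (Finset.univ.erase a) _
      (Finset.mem_erase.mpr ⟨hab.symm, Finset.mem_univ b⟩), setPair_left _ hab, setPair_right,
    mul_assoc]
  congr 2
  refine Finset.prod_congr rfl fun k hk => ?_
  simp only [Finset.mem_erase] at hk
  rw [setPair_of_ne _ _ hk.2.1 hk.1]

theorem setPair_self {κ : Type} (Q : Fin n → κ) (a b : Fin n) : setPair Q a b (Q a, Q b) = Q := by
  simp [setPair]

theorem pairOp_mul_gate {a b : Fin n} (hab : a ≠ b) (Q : Fin n → Fin 4)
    (X : Matrix (Fin 2 × Fin 2) (Fin 2 × Fin 2) ℂ) (u : U (Fin 2 × Fin 2)) :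
    pairOp a b Q X * twoQubitGate a b u = pairOp a b Q (X * u.1) := by
  ext x y
  simp only [pairOp, twoQubitGate, Matrix.mul_apply, Matrix.of_apply, mul_ite, mul_zero]
  rw [Finset.sum_mul, ← sum_agree_off_pair hab y]
  refine Finset.sum_congr rfl fun z _ => ?_
  split_ifs with hz
  · rw [Finset.prod_congr rfl (g := fun k => pauli (Q k) (x k) (y k))]
    · ring
    · intro k hk
      simp only [Finset.mem_erase] at hk
      rw [hz k hk.2.1 hk.1]
  · rfl

theorem gate_conjTranspose_mul_pairOp {a b : Fin n} (hab : a ≠ b) (Q : Fin n → Fin 4)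
    (X : Matrix (Fin 2 × Fin 2) (Fin 2 × Fin 2) ℂ) (u : U (Fin 2 × Fin 2)) :
    (twoQubitGate a b u).conjTranspose * pairOp a b Q X =
      pairOp a b Q (u.1.conjTranspose * X) := by
  ext x y
  simp only [pairOp, twoQubitGate, Matrix.mul_apply, Matrix.of_apply,
    Matrix.conjTranspose_apply]
  rw [Finset.sum_mul, ← sum_agree_off_pair hab x]
  refine Finset.sum_congr rfl fun z _ => ?_
  split_ifs with hz
  · rw [Finset.prod_congr rfl (g := fun k => pauli (Q k) (x k) (y k))]
    · ring
    · intro k hk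
      simp only [Finset.mem_erase] at hk
      rw [hz k hk.2.1 hk.1]
  · simp

theorem pairOp_sum {κ : Type} [Fintype κ] (a b : Fin n) (Q : Fin n → Fin 4) (c : κ → ℂ)
    (X : κ → Matrix (Fin 2 × Fin 2) (Fin 2 × Fin 2) ℂ) :
    pairOp a b Q (∑ s, c s • X s) = ∑ s, c s • pairOp a b Q (X s) := by
  ext x y
  simp only [pairOp, Matrix.of_apply, Matrix.sum_apply, Matrix.smul_apply, smul_eq_mul,
    Finset.sum_mul, mul_assoc]

/-- Heisenberg picture: the adjoint gate acts on the Pauli string and alters only its two letters on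
the pair, by the two-qubit transfer matrix. -/
theorem pauliCoeff_gate_conj {a b : Fin n} (hab : a ≠ b) (u : U (Fin 2 × Fin 2))
    (Q : Fin n → Fin 4) (A : Op n) :
    pauliCoeff Q (twoQubitGate a b u * A * (twoQubitGate a b u).conjTranspose) =
      ∑ s, frameTransfer pauliPair u.1 (Q a, Q b) s * pauliCoeff (setPair Q a b s) A := by
  have h1 : pauliCoeff Q (twoQubitGate a b u * A * (twoQubitGate a b u).conjTranspose) =
      (((twoQubitGate a b u).conjTranspose * pauliString Q * twoQubitGate a b u) * A).trace := by
    rw [pauliCoeff, ← mul_assoc, Matrix.trace_mul_comm]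
    simp only [mul_assoc]
  rw [h1]
  conv_lhs => rw [← setPair_self Q a b, ← pairOp_pauliPair hab]
  rw [gate_conjTranspose_mul_pairOp hab, pairOp_mul_gate hab, isPauliFrame_pauliPair.conj_eq_sum,
    pairOp_sum, Finset.sum_mul, Matrix.trace_sum]
  refine Finset.sum_congr rfl fun s _ => ?_
  rw [pairOp_pauliPair hab, Matrix.smul_mul, Matrix.trace_smul, smul_eq_mul]
  rfl

/-- Pauli expectation values in a state are bounded by one. -/
theorem norm_pauliCoeff_le_one {ρ : Op n} (hρ : IsState ρ) (Q : Fin n → Fin 4) :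
    ‖pauliCoeff Q ρ‖ ≤ 1 := by
  have hre : (starRingEnd ℂ) (pauliCoeff Q ρ) = pauliCoeff Q ρ := by
    change star _ = _
    rw [pauliCoeff, ← Matrix.trace_conjTranspose, Matrix.conjTranspose_mul,
      conjTranspose_pauliString, hρ.posSemidef.1.eq, Matrix.trace_mul_comm]
  obtain ⟨r, hr⟩ := Complex.conj_eq_iff_real.mp hre
  -- For ε = ±1 the operator 1 + εQ is twice a projection, so (1 + εQ) ρ (1 + εQ) is positive with
  -- trace 2(1 + εr).
  have key : ∀ ε : ℝ, ε * ε = 1 → 0 ≤ 1 + ε * r := by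
    intro ε hε
    have hε' : (ε : ℂ) * ε = 1 := by exact_mod_cast hε
    have hps := hρ.posSemidef.mul_mul_conjTranspose_same (1 + (ε : ℂ) • pauliString Q)
    have h2 : ((1 + (ε : ℂ) • pauliString Q) * ρ *
        (1 + (ε : ℂ) • pauliString Q).conjTranspose).trace = ((2 * (1 + ε * r) : ℝ) : ℂ) := by
      rw [Matrix.trace_mul_comm, ← mul_assoc, Matrix.conjTranspose_add,
        Matrix.conjTranspose_smul, conjTranspose_pauliString, Matrix.conjTranspose_one]
      have : (1 + star (ε : ℂ) • pauliString Q) * (1 + (ε : ℂ) • pauliString Q) =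
          (2 : ℂ) • (1 + (ε : ℂ) • pauliString Q) := by
        rw [show star (ε : ℂ) = ε from Complex.conj_ofReal ε]
        simp only [add_mul, mul_add, one_mul, mul_one, Matrix.smul_mul, Matrix.mul_smul, smul_smul,
          pauliString_mul_self, hε', one_smul]
        module
      rw [this, Matrix.smul_mul, Matrix.trace_smul, add_mul, one_mul, Matrix.trace_add,
        Matrix.smul_mul, Matrix.trace_smul, hρ.trace_eq_one]
      change 2 • (1 + (ε : ℂ) • pauliCoeff Q ρ) = _
      rw [hr]
      push_cast
      simp
    have h3 := hps.trace_nonneg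
    rw [h2, Complex.zero_le_real] at h3
    linarith
  have h1 := key 1 (by norm_num)
  have h2 := key (-1) (by norm_num)
  rw [hr, Complex.norm_real, Real.norm_eq_abs, abs_le]
  constructor <;> linarith

end

section

/-! Integration over independent gates -/

section Independence

variable {I X : Type} [Fintype I] [DecidableEq I] [MeasurableSpace X]

/-- Resampling one coordinate independently leaves a product law unchanged. -/
theorem map_update_prod_pi (ν : I → Measure X) [∀ i, IsProbabilityMeasure (ν i)] (i : I) :
    ((Measure.pi ν).prod (ν i)).map (fun p => Function.update p.1 i p.2) = Measure.pi ν := by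
  refine (Measure.pi_eq fun s hs => ?_).symm
  rw [Measure.map_apply measurable_update' (MeasurableSet.univ_pi hs)]
  have : (fun p : (I → X) × X => Function.update p.1 i p.2) ⁻¹' Set.univ.pi s =
      (Set.univ.pi (Function.update s i Set.univ)) ×ˢ s i := by
    ext ⟨u, x⟩
    simp only [Set.mem_preimage, Set.mem_pi, Set.mem_univ, true_imp_iff, Set.mem_prod]
    constructor
    · intro h
      refine ⟨fun j => ?_, by simpa using h i⟩
      by_cases hj : j = i
      · subst hj; simp
      · simpa [hj] using h j
    · rintro ⟨h1, h2⟩ j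
      by_cases hj : j = i
      · subst hj; simpa using h2
      · simpa [hj] using h1 j
  rw [this, Measure.prod_prod, Measure.pi_pi, ← Finset.prod_erase_mul _ _ (Finset.mem_univ i),
    ← Finset.prod_erase_mul (s := Finset.univ) (fun j => ν j (s j)) (Finset.mem_univ i)]
  simp only [Function.update_self, measure_univ, mul_one]
  congr 1
  refine Finset.prod_congr rfl fun j hj => ?_
  rw [Function.update_of_ne (Finset.ne_of_mem_erase hj)]

/-- Independence, with "g does not involve gate i" expressed as invariance under updates of
coordinate i. This form makes freshness of a gate easy to carry along a circuit. -/
theorem integral_pi_mul_of_update_eq (ν : I → Measure X) [∀ i, IsProbabilityMeasure (ν i)]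
    (i : I) {f : X → ℂ} {g : (I → X) → ℂ}
    (hm : AEStronglyMeasurable (fun u : I → X => f (u i) * g u) (Measure.pi ν))
    (hg : ∀ u x, g (Function.update u i x) = g u) :
    ∫ u, f (u i) * g u ∂Measure.pi ν = (∫ x, f x ∂ν i) * ∫ u, g u ∂Measure.pi ν := by
  conv_lhs => rw [← map_update_prod_pi ν i]
  rw [← map_update_prod_pi ν i] at hm
  rw [integral_map measurable_update'.aemeasurable hm]
  simp only [Function.update_self, hg]
  rw [mul_comm, ← integral_prod_mul]
  simp only [mul_comm]

end Independence

/-! Second moments of the Pauli coefficients of random operators -/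

variable {n : ℕ}

/-- `E[Tr(Q B) conj(Tr(R B))]` for a random operator `B`. -/
noncomputable def crossMoment {Ω : Type} [MeasurableSpace Ω] (μ : Measure Ω) (B : Ω → Op n)
    (Q R : Fin n → Fin 4) : ℂ :=
  ∫ u, pauliCoeff Q (B u) * star (pauliCoeff R (B u)) ∂μ

/-- `E[|Tr(Q B)|²]` for a random operator `B`. -/
noncomputable def pauliMoment {Ω : Type} [MeasurableSpace Ω] (μ : Measure Ω) (B : Ω → Op n)
    (Q : Fin n → Fin 4) : ℝ :=
  ∫ u, ‖pauliCoeff Q (B u)‖ ^ 2 ∂μ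

theorem crossMoment_self {Ω : Type} [MeasurableSpace Ω] (μ : Measure Ω) (B : Ω → Op n)
    (Q : Fin n → Fin 4) : crossMoment μ B Q Q = (pauliMoment μ B Q : ℂ) := by
  unfold crossMoment pauliMoment
  rw [← integral_complex_ofReal]
  congr 1
  funext u
  push_cast
  exact Complex.mul_conj' _

/-- The two-qubit gate `u` on the pair `ab`, acting by conjugation. -/
noncomputable def gateConj (ab : Fin n × Fin n) (u : U (Fin 2 × Fin 2)) (A : Op n) : Op n :=
  twoQubitGate ab.1 ab.2 u * A * (twoQubitGate ab.1 ab.2 u).conjTranspose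

/-- The average effect of a random gate on the second moments of the Pauli coefficients. -/
noncomputable def gateStep (ab : Fin n × Fin n) (m : (Fin n → Fin 4) → ℝ)
    (Q : Fin n → Fin 4) : ℝ :=
  ∑ s, frameWeight (0, 0) (Q ab.1, Q ab.2) s * m (setPair Q ab.1 ab.2 s)

theorem continuous_twoQubitGate (a b : Fin n) :
    Continuous (twoQubitGate a b : U (Fin 2 × Fin 2) → Op n) := by
  refine continuous_matrix fun x y => ?_
  simp only [twoQubitGate, Matrix.of_apply]
  split_ifs
  · exact continuous_subtype_val.matrix_elem _ _
  · exact continuous_const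

@[fun_prop]
theorem continuous_gateConj {X : Type*} [TopologicalSpace X] {f : X → U (Fin 2 × Fin 2)}
    {B : X → Op n} (hf : Continuous f) (hB : Continuous B) (ab : Fin n × Fin n) :
    Continuous fun x => gateConj ab (f x) (B x) := by
  have := (continuous_twoQubitGate ab.1 ab.2).comp hf
  exact (this.matrix_mul hB).matrix_mul this.matrix_conjTranspose

/-- Consecutive gates, the first of the list acting first. -/
noncomputable def applyGates {I : Type} (site : I → Fin n × Fin n) (gs : List I)
    (u : I → U (Fin 2 × Fin 2)) (A : Op n) : Op n :=
  gs.foldl (fun B i => gateConj (site i) (u i) B) A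

theorem continuous_applyGates {I : Type} (site : I → Fin n × Fin n) (gs : List I)
    {B : (I → U (Fin 2 × Fin 2)) → Op n} (hB : Continuous B) :
    Continuous fun u => applyGates site gs u (B u) := by
  induction gs generalizing B with
  | nil => exact hB
  | cons i gs ih =>
    exact ih (B := fun u => gateConj (site i) (u i) (B u))
      (continuous_gateConj (continuous_apply i) hB _)

theorem applyGates_update {I : Type} [DecidableEq I] (site : I → Fin n × Fin n) {gs : List I} {i : I} (hi : i ∉ gs)
    (u : I → U (Fin 2 × Fin 2)) (x : U (Fin 2 × Fin 2)) (A : Op n) :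
    applyGates site gs (Function.update u i x) A = applyGates site gs u A := by
  induction gs generalizing A with
  | nil => rfl
  | cons j gs ih =>
    simp only [List.mem_cons, not_or] at hi
    simp only [applyGates, List.foldl_cons, Function.update_of_ne (Ne.symm hi.1)]
    exact ih hi.2 _

section Gates

variable {I : Type} [Fintype I] [DecidableEq I] {ν : I → Measure (U (Fin 2 × Fin 2))}

/-- The gate is independent of B, so the mean of its transfer entries factors out. Their
orthogonality forces equal letters on the pair and replaces both pairs of letters by the same s. -/
theorem crossMoment_gateConj (hν : ∀ i, IsTwoDesign (ν i)) {ab : Fin n × Fin n}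
    (hab : ab.1 ≠ ab.2) (i : I) {B : (I → U (Fin 2 × Fin 2)) → Op n} (hB : Continuous B)
    (hi : ∀ u x, B (Function.update u i x) = B u) (Q R : Fin n → Fin 4) :
    crossMoment (Measure.pi ν) (fun u => gateConj ab (u i) (B u)) Q R =
      if (Q ab.1, Q ab.2) = (R ab.1, R ab.2) then
        ∑ s, (frameWeight (0, 0) (Q ab.1, Q ab.2) s : ℂ) *
          crossMoment (Measure.pi ν) B (setPair Q ab.1 ab.2 s) (setPair R ab.1 ab.2 s)
      else 0 := by
  have := fun i => (hν i).isProb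
  unfold crossMoment
  have h1 : ∀ u : I → U (Fin 2 × Fin 2), pauliCoeff Q (gateConj ab (u i) (B u)) *
      star (pauliCoeff R (gateConj ab (u i) (B u))) =
      ∑ s, ∑ t, (frameTransfer pauliPair (u i).1 (Q ab.1, Q ab.2) s *
        frameTransfer pauliPair (u i).1 (R ab.1, R ab.2) t) *
        (pauliCoeff (setPair Q ab.1 ab.2 s) (B u) *
          star (pauliCoeff (setPair R ab.1 ab.2 t) (B u))) := by
    intro u
    rw [gateConj, pauliCoeff_gate_conj hab, pauliCoeff_gate_conj hab, star_sum,
      Finset.sum_mul_sum]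
    refine Finset.sum_congr rfl fun s _ => Finset.sum_congr rfl fun t _ => ?_
    rw [star_mul', isPauliFrame_pauliPair.star_frameTransfer]
    ring
  have hc : ∀ s t, Continuous fun u : I → U (Fin 2 × Fin 2) =>
      (frameTransfer pauliPair (u i).1 (Q ab.1, Q ab.2) s *
        frameTransfer pauliPair (u i).1 (R ab.1, R ab.2) t) *
        (pauliCoeff (setPair Q ab.1 ab.2 s) (B u) *
          star (pauliCoeff (setPair R ab.1 ab.2 t) (B u))) := by
    intro s t
    fun_prop
  simp only [h1]
  rw [integral_finsetSum _ fun s _ => Continuous.integrable_of_compactSpace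
    (continuous_finsetSum _ fun t _ => hc s t)]
  have h2 : ∀ s, ∫ u, ∑ t, (frameTransfer pauliPair (u i).1 (Q ab.1, Q ab.2) s *
        frameTransfer pauliPair (u i).1 (R ab.1, R ab.2) t) *
        (pauliCoeff (setPair Q ab.1 ab.2 s) (B u) *
          star (pauliCoeff (setPair R ab.1 ab.2 t) (B u))) ∂Measure.pi ν =
      ∑ t, (if (Q ab.1, Q ab.2) = (R ab.1, R ab.2) ∧ s = t then
          (frameWeight (0, 0) (Q ab.1, Q ab.2) s : ℂ) else 0) *
        ∫ u, (pauliCoeff (setPair Q ab.1 ab.2 s) (B u) *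
          star (pauliCoeff (setPair R ab.1 ab.2 t) (B u))) ∂Measure.pi ν := by
    intro s
    rw [integral_finsetSum _ fun t _ => (hc s t).integrable_of_compactSpace]
    refine Finset.sum_congr rfl fun t _ => ?_
    rw [← isPauliFrame_pauliPair.integral_design (hν i)]
    exact integral_pi_mul_of_update_eq ν i
      (f := fun x => frameTransfer pauliPair x.1 (Q ab.1, Q ab.2) s *
        frameTransfer pauliPair x.1 (R ab.1, R ab.2) t)
      (g := fun u => pauliCoeff (setPair Q ab.1 ab.2 s) (B u) *
          star (pauliCoeff (setPair R ab.1 ab.2 t) (B u)))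
      (hc s t).aestronglyMeasurable (fun u x => by simp only [hi])
  simp only [h2]
  by_cases h : (Q ab.1, Q ab.2) = (R ab.1, R ab.2)
  · simp [h]
  · simp [h]

theorem pauliMoment_gateConj (hν : ∀ i, IsTwoDesign (ν i)) {ab : Fin n × Fin n}
    (hab : ab.1 ≠ ab.2) (i : I) {B : (I → U (Fin 2 × Fin 2)) → Op n} (hB : Continuous B)
    (hi : ∀ u x, B (Function.update u i x) = B u) :
    pauliMoment (Measure.pi ν) (fun u => gateConj ab (u i) (B u)) =
      gateStep ab (pauliMoment (Measure.pi ν) B) := by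
  funext Q
  have := crossMoment_gateConj hν hab i hB hi Q Q
  simp only [crossMoment_self, if_true] at this
  unfold gateStep
  exact_mod_cast this

/-- Pauli coefficients that differ on a qubit satisfying `D` are uncorrelated. -/
def UncorrelatedOn {Ω : Type} [MeasurableSpace Ω] (μ : Measure Ω) (B : Ω → Op n)
    (D : Fin n → Prop) : Prop :=
  ∀ Q R k, D k → Q k ≠ R k → crossMoment μ B Q R = 0

/-- A gate decorrelates its own two qubits and preserves decorrelation elsewhere, because it
substitutes common letters and leaves a disagreement off the pair in place. -/
theorem UncorrelatedOn.gateConj (hν : ∀ i, IsTwoDesign (ν i)) {ab : Fin n × Fin n}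
    (hab : ab.1 ≠ ab.2) (i : I) {B : (I → U (Fin 2 × Fin 2)) → Op n} (hB : Continuous B)
    (hi : ∀ u x, B (Function.update u i x) = B u) {D : Fin n → Prop}
    (hD : UncorrelatedOn (Measure.pi ν) B D) :
    UncorrelatedOn (Measure.pi ν) (fun u => gateConj ab (u i) (B u))
      (fun k => D k ∨ k = ab.1 ∨ k = ab.2) := by
  intro Q R k hk hne
  rw [crossMoment_gateConj hν hab i hB hi]
  split_ifs with h
  · rw [Prod.mk.injEq] at h
    have ha : k ≠ ab.1 := by rintro rfl; exact hne h.1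
    have hb : k ≠ ab.2 := by rintro rfl; exact hne h.2
    have hDk : D k := by tauto
    refine Finset.sum_eq_zero fun s _ => ?_
    rw [hD _ _ k hDk, mul_zero]
    rwa [setPair_of_ne _ _ ha hb, setPair_of_ne _ _ ha hb]
  · rfl

/-- Gates in the list may overlap in qubits. Only freshness matters: no index repeats and B involves
none of them, so each gate is independent of the operator on which it acts. -/
theorem moments_applyGates (hν : ∀ i, IsTwoDesign (ν i)) {site : I → Fin n × Fin n}
    (hsite : ∀ i, (site i).1 ≠ (site i).2) {gs : List I} (hgs : gs.Nodup)
    {B : (I → U (Fin 2 × Fin 2)) → Op n} (hB : Continuous B)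
    (hi : ∀ i ∈ gs, ∀ u x, B (Function.update u i x) = B u) {D : Fin n → Prop}
    (hD : UncorrelatedOn (Measure.pi ν) B D) :
    pauliMoment (Measure.pi ν) (fun u => applyGates site gs u (B u)) =
      gs.foldl (fun m i => gateStep (site i) m) (pauliMoment (Measure.pi ν) B) ∧
    UncorrelatedOn (Measure.pi ν) (fun u => applyGates site gs u (B u))
      (fun k => D k ∨ ∃ i ∈ gs, k = (site i).1 ∨ k = (site i).2) := by
  induction gs generalizing B D with
  | nil =>
    refine ⟨rfl, fun Q R k hk => hD Q R k ?_⟩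
    simpa using hk
  | cons i gs ih =>
    rw [List.nodup_cons] at hgs
    have hi0 := hi i (by simp)
    obtain ⟨h1, h2⟩ := ih hgs.2 (B := fun u => gateConj (site i) (u i) (B u))
      (continuous_gateConj (continuous_apply i) hB _) (fun j hj u x => by
        have hij : i ≠ j := by rintro rfl; exact hgs.1 hj
        simp only [Function.update_of_ne hij, hi j (List.mem_cons_of_mem _ hj)])
      (hD.gateConj hν (hsite i) i hB hi0)
    refine ⟨?_, ?_⟩
    · rw [List.foldl_cons, ← pauliMoment_gateConj hν (hsite i) i hB hi0]
      exact h1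
    · intro Q R k hk
      refine h2 Q R k ?_
      simpa [or_assoc] using hk

end Gates

/-! Support averages -/

/-- The average of `m` over all Pauli strings with the support of `Q`. -/
noncomputable def supportAvg (m : (Fin n → Fin 4) → ℝ) (Q : Fin n → Fin 4) : ℝ :=
  ∑ R : Fin n → Fin 4, (∏ k, frameWeight 0 (Q k) (R k)) * m R

theorem prod_frameWeight_nonneg (Q R : Fin n → Fin 4) :
    0 ≤ ∏ k, frameWeight 0 (Q k) (R k) :=
  Finset.prod_nonneg fun _ _ => frameWeight_nonneg _ _ _

theorem sum_prod_frameWeight (Q : Fin n → Fin 4) :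
    ∑ R : Fin n → Fin 4, ∏ k, frameWeight 0 (Q k) (R k) = 1 := by
  rw [← prod_sum_eq_sum_prod fun k s => frameWeight 0 (Q k) s]
  simp [sum_frameWeight]

theorem supportAvg_mono {m m' : (Fin n → Fin 4) → ℝ} (h : ∀ Q, m Q ≤ m' Q) (Q : Fin n → Fin 4) :
    supportAvg m Q ≤ supportAvg m' Q :=
  Finset.sum_le_sum fun R _ => mul_le_mul_of_nonneg_left (h R) (prod_frameWeight_nonneg Q R)

theorem supportAvg_le {m : (Fin n → Fin 4) → ℝ} {β : ℝ} (h : ∀ Q, m Q ≤ β) (Q : Fin n → Fin 4) :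
    supportAvg m Q ≤ β := by
  refine (supportAvg_mono h Q).trans ?_
  rw [supportAvg, ← Finset.sum_mul, sum_prod_frameWeight, one_mul]

theorem supportAvg_zero (m : (Fin n → Fin 4) → ℝ) : supportAvg m 0 = m 0 := by
  rw [supportAvg, Finset.sum_eq_single 0]
  · simp [frameWeight]
  · intro R _ hR
    obtain ⟨k, hk⟩ := Function.ne_iff.mp hR
    rw [Finset.prod_eq_zero (Finset.mem_univ k), zero_mul]
    simpa [frameWeight] using hk
  · simp

/-- The adjoint of a gate step. Exchanging the letters on the pair with the summation variable is an
involution of pairs (Q, s), and it serves as the change of variables. -/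
theorem sum_mul_gateStep {ab : Fin n × Fin n} (hab : ab.1 ≠ ab.2) (p m : (Fin n → Fin 4) → ℝ) :
    ∑ Q, p Q * gateStep ab m Q =
      ∑ R, (∑ s, p (setPair R ab.1 ab.2 s) * frameWeight (0, 0) s (R ab.1, R ab.2)) * m R := by
  simp only [gateStep, Finset.mul_sum, Finset.sum_mul]
  rw [← Fintype.sum_prod_type', ← Fintype.sum_prod_type']
  have key : ∀ (Q : Fin n → Fin 4) (s : Fin 4 × Fin 4), setPair (setPair Q ab.1 ab.2 s) ab.1 ab.2
      (Q ab.1, Q ab.2) = Q := by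
    intro Q s
    funext k
    by_cases hb : k = ab.2
    · subst hb; rw [setPair_right]
    by_cases ha : k = ab.1
    · subst ha; rw [setPair_left _ hab]
    · rw [setPair_of_ne _ _ ha hb, setPair_of_ne _ _ ha hb]
  refine Finset.sum_nbij' (fun x => (setPair x.1 ab.1 ab.2 x.2, (x.1 ab.1, x.1 ab.2)))
    (fun x => (setPair x.1 ab.1 ab.2 x.2, (x.1 ab.1, x.1 ab.2))) ?_ ?_ ?_ ?_ ?_
  · simp
  · simp
  · rintro ⟨Q, s⟩ _
    simp only [key, setPair_left _ hab, setPair_right]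
  · rintro ⟨Q, s⟩ _
    simp only [key, setPair_left _ hab, setPair_right]
  · rintro ⟨Q, s⟩ _
    simp only [key, setPair_left _ hab, setPair_right]
    ring

/-- A sequence of gates evaluates m by a probability vector p. On covered qubits p sees only which
letters are the identity, because `frameWeight` does; this survives each adjoint step even when
gates overlap. -/
theorem exists_weights_foldl_gateStep {I : Type} {site : I → Fin n × Fin n}
    (hsite : ∀ i, (site i).1 ≠ (site i).2) (gs : List I) (Q : Fin n → Fin 4) :
    ∃ p : (Fin n → Fin 4) → ℝ, (∀ R, 0 ≤ p R) ∧ ∑ R, p R = 1 ∧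
      (∀ R R' : Fin n → Fin 4,
        (∀ k, (∃ i ∈ gs, k = (site i).1 ∨ k = (site i).2) → (R k = 0 ↔ R' k = 0)) →
        (∀ k, (¬ ∃ i ∈ gs, k = (site i).1 ∨ k = (site i).2) → R k = R' k) → p R = p R') ∧
      ∀ m, gs.foldl (fun m i => gateStep (site i) m) m Q = ∑ R, p R * m R := by
  induction gs with
  | nil =>
    refine ⟨fun R => if R = Q then 1 else 0, fun R => by positivity, by simp, ?_,
      by simp⟩
    intro R R' _ h
    rw [show R = R' from funext fun k => h k (by simp)]
  | cons i gs ih =>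
    obtain ⟨p, hp0, hp1, hpinv, hpm⟩ := ih
    -- The head of the list acts first on m, so the weights for the tail are pushed through the
    -- adjoint of its step.
    refine ⟨fun R => ∑ s, p (setPair R (site i).1 (site i).2 s) *
      frameWeight (0, 0) s (R (site i).1, R (site i).2), ?_, ?_, ?_, ?_⟩
    · exact fun R => Finset.sum_nonneg fun s _ =>
        mul_nonneg (hp0 _) (frameWeight_nonneg _ _ _)
    · have := sum_mul_gateStep (hsite i) p 1
      simp only [Pi.one_apply, mul_one, gateStep, sum_frameWeight] at this
      rw [← this, hp1]
    · intro R R' h1 h2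
      refine Finset.sum_congr rfl fun s _ => ?_
      have hw : frameWeight (0, 0) s (R (site i).1, R (site i).2) =
          frameWeight (0, 0) s (R' (site i).1, R' (site i).2) := by
        have e1 := h1 (site i).1 ⟨i, by simp, Or.inl rfl⟩
        have e2 := h1 (site i).2 ⟨i, by simp, Or.inr rfl⟩
        simp only [frameWeight, Prod.mk.injEq, e1, e2]
      have ho : ∀ k, k ≠ (site i).1 → k ≠ (site i).2 →
          (∃ j ∈ i :: gs, k = (site j).1 ∨ k = (site j).2) →
          ∃ j ∈ gs, k = (site j).1 ∨ k = (site j).2 := by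
        rintro k ha hb ⟨j, hj, hk⟩
        rcases List.mem_cons.mp hj with rfl | hj
        · tauto
        · exact ⟨j, hj, hk⟩
      rw [hw]
      congr 1
      apply hpinv
      · rintro k ⟨j, hj, hk⟩
        by_cases hb : k = (site i).2
        · subst hb; simp only [setPair_right]
        by_cases ha : k = (site i).1
        · subst ha; simp only [setPair_left _ (hsite i)]
        · rw [setPair_of_ne _ _ ha hb, setPair_of_ne _ _ ha hb]
          exact h1 k ⟨j, List.mem_cons_of_mem _ hj, hk⟩
      · intro k hk
        by_cases hb : k = (site i).2
        · subst hb; simp only [setPair_right]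
        by_cases ha : k = (site i).1
        · subst ha; simp only [setPair_left _ (hsite i)]
        · rw [setPair_of_ne _ _ ha hb, setPair_of_ne _ _ ha hb]
          exact h2 k fun hh => hk (ho k ha hb hh)
    · intro m
      rw [List.foldl_cons, hpm, sum_mul_gateStep (hsite i)]

/-- When every qubit is covered, p is constant on strings of equal support. Support averaging is
symmetric and stochastic, so it fixes p; hence averaging m against p is the same as averaging
`supportAvg m` against p. -/
theorem foldl_gateStep_le {I : Type} {site : I → Fin n × Fin n} (hsite : ∀ i, (site i).1 ≠ (site i).2)
    {gs : List I} (hcov : ∀ k, ∃ i ∈ gs, k = (site i).1 ∨ k = (site i).2)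
    {m : (Fin n → Fin 4) → ℝ} {β : ℝ} (hm : ∀ R, supportAvg m R ≤ β) (Q : Fin n → Fin 4) :
    gs.foldl (fun m i => gateStep (site i) m) m Q ≤ β := by
  obtain ⟨p, hp0, hp1, hpinv, hpm⟩ := exists_weights_foldl_gateStep hsite gs Q
  -- Detailed balance: both sides vanish for different supports, and for equal supports p takes
  -- equal values.
  have hinv : ∀ R R' : Fin n → Fin 4,
      p R * ∏ k, frameWeight 0 (R k) (R' k) = p R' * ∏ k, frameWeight 0 (R' k) (R k) := by
    intro R R'
    have hs : ∏ k, frameWeight 0 (R k) (R' k) = ∏ k, frameWeight 0 (R' k) (R k) :=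
      Finset.prod_congr rfl fun k _ => frameWeight_comm _ _ _
    by_cases h : ∀ k, R k = 0 ↔ R' k = 0
    · rw [hpinv R R' (fun k _ => h k) (fun k hk => absurd (hcov k) hk), hs]
    · push Not at h
      obtain ⟨k, hk⟩ := h
      have hz : ∏ k, frameWeight 0 (R k) (R' k) = 0 := by
        refine Finset.prod_eq_zero (Finset.mem_univ k) ?_
        unfold frameWeight
        rcases hk with hk | hk <;> simp [hk]
      rw [← hs, hz, mul_zero, mul_zero]
  calc gs.foldl (fun m i => gateStep (site i) m) m Q = ∑ R, p R * m R := hpm m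
    _ = ∑ R' : Fin n → Fin 4, ∑ R : Fin n → Fin 4,
          p R' * (∏ k, frameWeight 0 (R' k) (R k)) * m R' := by
        refine Finset.sum_congr rfl fun R' _ => ?_
        rw [← Finset.sum_mul, ← Finset.mul_sum, sum_prod_frameWeight, mul_one]
    _ = ∑ R, p R * supportAvg m R := by
        rw [Finset.sum_comm]
        refine Finset.sum_congr rfl fun R _ => ?_
        rw [supportAvg, Finset.mul_sum]
        refine Finset.sum_congr rfl fun R' _ => ?_
        rw [← hinv, mul_assoc]
    _ ≤ ∑ R, p R * β := Finset.sum_le_sum fun R _ => mul_le_mul_of_nonneg_left (hm R) (hp0 R)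
    _ = β := by rw [← Finset.sum_mul, hp1, one_mul]

/-! Noise -/

/-- The effect of the noise on the second moments of uncorrelated Pauli coefficients. -/
noncomputable def noiseStep (N : Op1 →ₗ[ℂ] Op1) (m : (Fin n → Fin 4) → ℝ)
    (Q : Fin n → Fin 4) : ℝ :=
  ∑ R : Fin n → Fin 4, (∏ k, ‖pauliTransfer N (Q k) (R k)‖ ^ 2) * m R

/-- The contraction constant of a channel, `(∑_{q ≠ I, r} |T_{q,r}|²) / 3`. -/
noncomputable def noiseConst (N : Op1 →ₗ[ℂ] Op1) : ℝ :=
  (∑ q ∈ Finset.univ.erase 0, ∑ r, ‖pauliTransfer N q r‖ ^ 2) / 3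

theorem noiseConst_nonneg (N : Op1 →ₗ[ℂ] Op1) : 0 ≤ noiseConst N :=
  div_nonneg (Finset.sum_nonneg fun _ _ => Finset.sum_nonneg fun _ _ => sq_nonneg _)
    (by norm_num)

theorem continuous_noiseLayer (N : Op1 →ₗ[ℂ] Op1) {X : Type*} [TopologicalSpace X]
    {B : X → Op n} (hB : Continuous B) : Continuous fun x => noiseLayer n N (B x) := by
  unfold noiseLayer
  fun_prop

/-- Decorrelation on every qubit removes all cross terms of the expanded square, leaving the squared
moduli of the transfer entries. -/
theorem pauliMoment_noiseLayer (N : Op1 →ₗ[ℂ] Op1) {Ω : Type} [TopologicalSpace Ω] [CompactSpace Ω]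
    [MeasurableSpace Ω] [OpensMeasurableSpace Ω] (μ : Measure Ω) [IsFiniteMeasure μ]
    {B : Ω → Op n} (hB : Continuous B) (hD : UncorrelatedOn μ B fun _ => True) :
    pauliMoment μ (fun u => noiseLayer n N (B u)) = noiseStep N (pauliMoment μ B) := by
  funext Q
  have h1 : ∀ u, pauliCoeff Q (noiseLayer n N (B u)) * star (pauliCoeff Q (noiseLayer n N (B u))) =
      ∑ R : Fin n → Fin 4, ∑ S : Fin n → Fin 4,
        ((∏ k, pauliTransfer N (Q k) (R k)) * star (∏ k, pauliTransfer N (Q k) (S k))) *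
        (pauliCoeff R (B u) * star (pauliCoeff S (B u))) := by
    intro u
    rw [pauliCoeff_noiseLayer, star_sum, Finset.sum_mul_sum]
    refine Finset.sum_congr rfl fun s _ => Finset.sum_congr rfl fun t _ => ?_
    rw [star_mul']
    ring
  have hc : ∀ R S, Integrable (fun u => ((∏ k, pauliTransfer N (Q k) (R k)) *
      star (∏ k, pauliTransfer N (Q k) (S k))) *
        (pauliCoeff R (B u) * star (pauliCoeff S (B u)))) μ := by
    intro R S
    refine Continuous.integrable_of_compactSpace ?_
    fun_prop
  have h2 : crossMoment μ (fun u => noiseLayer n N (B u)) Q Q =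
      ∑ R : Fin n → Fin 4, ∑ S : Fin n → Fin 4,
        ((∏ k, pauliTransfer N (Q k) (R k)) * star (∏ k, pauliTransfer N (Q k) (S k))) *
        crossMoment μ B R S := by
    simp only [crossMoment, h1]
    rw [integral_finsetSum _ fun R _ => integrable_finsetSum _ fun S _ => hc R S]
    refine Finset.sum_congr rfl fun R _ => ?_
    rw [integral_finsetSum _ fun S _ => hc R S]
    simp only [integral_const_mul]
  have h3 : ∀ R : Fin n → Fin 4, ∑ S : Fin n → Fin 4,
        ((∏ k, pauliTransfer N (Q k) (R k)) * star (∏ k, pauliTransfer N (Q k) (S k))) *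
        crossMoment μ B R S =
        (((∏ k, ‖pauliTransfer N (Q k) (R k)‖ ^ 2) * pauliMoment μ B R : ℝ) : ℂ) := by
    intro R
    rw [Finset.sum_eq_single R]
    · rw [crossMoment_self]
      push_cast
      congr 1
      rw [show star (∏ k, pauliTransfer N (Q k) (R k)) =
        (starRingEnd ℂ) (∏ k, pauliTransfer N (Q k) (R k)) from rfl, Complex.mul_conj',
        norm_prod, Complex.ofReal_prod, Finset.prod_pow]
    · intro S _ hS
      obtain ⟨k, hk⟩ := Function.ne_iff.mp hS
      rw [hD R S k trivial hk.symm, mul_zero]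
    · simp
  simp only [h3, crossMoment_self] at h2
  unfold noiseStep
  exact_mod_cast h2

/-- With m replaced by the constant β the double sum factors over qubits. A non-identity letter
averages the three non-identity rows and gives `noiseConst N`; an identity letter gives one, the
identity row being a unit vector by `hN`. -/
theorem supportAvg_noiseStep_le {N : Op1 →ₗ[ℂ] Op1}
    (hN : ∀ r, pauliTransfer N 0 r = if r = 0 then 1 else 0)
    {m : (Fin n → Fin 4) → ℝ} {β : ℝ} (hm : ∀ R, m R ≤ β) (Q : Fin n → Fin 4) :
    supportAvg (noiseStep N m) Q ≤ noiseConst N ^ pauliWeight Q * β := by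
  have h1 : ∀ q : Fin 4, ∑ r, ∑ s, frameWeight 0 q r * ‖pauliTransfer N r s‖ ^ 2 =
      if q ≠ 0 then noiseConst N else 1 := by
    intro q
    rw [← Finset.add_sum_erase Finset.univ
      (fun r => ∑ s, frameWeight 0 q r * ‖pauliTransfer N r s‖ ^ 2) (Finset.mem_univ 0)]
    by_cases hq : q = 0
    · have h0 : ∑ r ∈ Finset.univ.erase 0, ∑ s, frameWeight 0 q r * ‖pauliTransfer N r s‖ ^ 2 =
          0 := by
        refine Finset.sum_eq_zero fun r hr => ?_
        simp [hq, frameWeight, Finset.ne_of_mem_erase hr]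
      rw [h0]
      simp [hq, frameWeight, hN, apply_ite]
    · have h0 : ∑ r ∈ Finset.univ.erase 0, ∑ s, frameWeight 0 q r * ‖pauliTransfer N r s‖ ^ 2 =
          ∑ r ∈ Finset.univ.erase 0, (1 / 3) * ∑ s, ‖pauliTransfer N r s‖ ^ 2 := by
        refine Finset.sum_congr rfl fun r hr => ?_
        simp only [hq, frameWeight, Finset.ne_of_mem_erase hr, if_false, Finset.mul_sum]
        norm_num
      have hz : ∑ s, frameWeight 0 q 0 * ‖pauliTransfer N 0 s‖ ^ 2 = 0 := by
        simp [hq, frameWeight]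
      rw [hz, h0, if_pos hq, noiseConst, zero_add, Finset.sum_div]
      exact Finset.sum_congr rfl fun r _ => by ring
  calc supportAvg (noiseStep N m) Q ≤ supportAvg (noiseStep N fun _ => β) Q := by
        refine supportAvg_mono (fun R => Finset.sum_le_sum fun S _ =>
          mul_le_mul_of_nonneg_left (hm S) (Finset.prod_nonneg fun _ _ => sq_nonneg _)) Q
    _ = (∏ k, ∑ r, ∑ s, frameWeight 0 (Q k) r * ‖pauliTransfer N r s‖ ^ 2) * β := by
        simp only [supportAvg, noiseStep, ← Finset.mul_sum, ← Finset.sum_mul, prod_sum_eq_sum_prod,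
          Finset.prod_mul_distrib, ← mul_assoc]
    _ = _ := by
        simp only [h1]
        rw [Finset.prod_ite, Finset.prod_const, Finset.prod_const_one, mul_one]
        rfl

end

/-! Noisy circuits -/

namespace RandomCircuit

variable {n L : ℕ}

/-- The index set of the two-qubit gates. -/
abbrev GateIdx (C : RandomCircuit n L) : Type := Σ ℓ : Fin L, Fin (C.numGates ℓ)

/-- The gates of layer `ℓ`, in the order in which they act. -/
def layerGates (C : RandomCircuit n L) (ℓ : Fin L) : List C.GateIdx :=
  (List.finRange (C.numGates ℓ)).map fun g => ⟨ℓ, g⟩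

/-- The pair of qubits on which a gate acts. -/
def gateSite (C : RandomCircuit n L) (i : C.GateIdx) : Fin n × Fin n := C.site i.1 i.2

/-- One noisy layer, as a function of the two-qubit gates. -/
noncomputable def layerMap (C : RandomCircuit n L) (N : Op1 →ₗ[ℂ] Op1)
    (v : C.GateIdx → U (Fin 2 × Fin 2)) (ℓ : Fin L) (A : Op n) : Op n :=
  noiseLayer n N (applyGates C.gateSite (C.layerGates ℓ) v A)

/-- A list of noisy layers, the first one acting first. -/
noncomputable def evolve (C : RandomCircuit n L) (N : Op1 →ₗ[ℂ] Op1)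
    (v : C.GateIdx → U (Fin 2 × Fin 2)) (ls : List (Fin L)) (A : Op n) : Op n :=
  ls.foldl (fun B ℓ => C.layerMap N v ℓ B) A

theorem layerUnitary_conj (C : RandomCircuit n L) (u : C.Gates) (ℓ : Fin L) (A : Op n) :
    C.layerUnitary u ℓ * A * (C.layerUnitary u ℓ).conjTranspose =
      applyGates C.gateSite (C.layerGates ℓ) u.1 A := by
  have key : ∀ (gs : List (Fin (C.numGates ℓ))) (W : Op n),
      (gs.foldl (fun W g => twoQubitGate (C.site ℓ g).1 (C.site ℓ g).2 (u.1 ⟨ℓ, g⟩) * W) W) * A *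
        (gs.foldl (fun W g => twoQubitGate (C.site ℓ g).1 (C.site ℓ g).2 (u.1 ⟨ℓ, g⟩) * W)
          W).conjTranspose =
      applyGates C.gateSite (gs.map fun g => ⟨ℓ, g⟩) u.1 (W * A * W.conjTranspose) := by
    intro gs
    induction gs with
    | nil => intro W; rfl
    | cons g gs ih =>
      intro W
      rw [List.foldl_cons, ih]
      simp only [applyGates, List.map_cons, List.foldl_cons]
      congr 1
      simp only [gateConj, gateSite, Matrix.conjTranspose_mul, mul_assoc]
  simpa [layerUnitary, layerGates] using key (List.finRange (C.numGates ℓ)) 1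

theorem lastLayers_eq (C : RandomCircuit n L) (N : Op1 →ₗ[ℂ] Op1) (u : C.Gates) (l : ℕ)
    (A : Op n) :
    C.lastLayers N u l A = tensorOp (fun q => (u.2 q).1) *
      C.evolve N u.1 ((List.finRange L).drop (L - l)) A *
      (tensorOp fun q => (u.2 q).1).conjTranspose := by
  unfold lastLayers evolve
  congr 3
  funext B ℓ
  rw [noisyLayer, layerUnitary_conj]
  rfl

theorem layerMap_sub (C : RandomCircuit n L) (N : Op1 →ₗ[ℂ] Op1)
    (v : C.GateIdx → U (Fin 2 × Fin 2)) (ℓ : Fin L) (A B : Op n) :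
    C.layerMap N v ℓ (A - B) = C.layerMap N v ℓ A - C.layerMap N v ℓ B := by
  have h1 : ∀ (gs : List C.GateIdx) (A B : Op n), applyGates C.gateSite gs v (A - B) =
      applyGates C.gateSite gs v A - applyGates C.gateSite gs v B := by
    intro gs
    induction gs with
    | nil => intro A B; rfl
    | cons g gs ih =>
      intro A B
      simp only [applyGates, List.foldl_cons] at ih ⊢
      rw [← ih]
      congr 1
      simp only [gateConj, mul_sub, sub_mul]
  simp only [layerMap, h1, noiseLayer, Matrix.sub_apply, sub_smul, Finset.sum_sub_distrib]

theorem evolve_sub (C : RandomCircuit n L) (N : Op1 →ₗ[ℂ] Op1)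
    (v : C.GateIdx → U (Fin 2 × Fin 2)) (ls : List (Fin L)) (A B : Op n) :
    C.evolve N v ls (A - B) = C.evolve N v ls A - C.evolve N v ls B := by
  induction ls generalizing A B with
  | nil => rfl
  | cons ℓ ls ih =>
    simp only [evolve, List.foldl_cons] at ih ⊢
    rw [layerMap_sub, ih]

theorem evolve_append (C : RandomCircuit n L) (N : Op1 →ₗ[ℂ] Op1)
    (v : C.GateIdx → U (Fin 2 × Fin 2)) (ls ls' : List (Fin L)) (A : Op n) :
    C.evolve N v (ls ++ ls') A = C.evolve N v ls' (C.evolve N v ls A) :=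
  List.foldl_append

theorem continuous_layerMap (C : RandomCircuit n L) (N : Op1 →ₗ[ℂ] Op1)
    {B : (C.GateIdx → U (Fin 2 × Fin 2)) → Op n} (hB : Continuous B) (ℓ : Fin L) :
    Continuous fun v => C.layerMap N v ℓ (B v) :=
  continuous_noiseLayer N (continuous_applyGates _ _ hB)

theorem continuous_evolve (C : RandomCircuit n L) (N : Op1 →ₗ[ℂ] Op1)
    {B : (C.GateIdx → U (Fin 2 × Fin 2)) → Op n} (hB : Continuous B) (ls : List (Fin L)) :
    Continuous fun v => C.evolve N v ls (B v) := by
  induction ls generalizing B with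
  | nil => exact hB
  | cons ℓ ls ih =>
    exact ih (B := fun v => C.layerMap N v ℓ (B v)) (C.continuous_layerMap N hB ℓ)

theorem nodup_layerGates (C : RandomCircuit n L) (ℓ : Fin L) : (C.layerGates ℓ).Nodup :=
  (List.nodup_finRange _).map fun g g' h => by simpa using h

theorem fst_of_mem_layerGates (C : RandomCircuit n L) {ℓ : Fin L} {i : C.GateIdx}
    (hi : i ∈ C.layerGates ℓ) : i.1 = ℓ := by
  simp only [layerGates, List.mem_map] at hi
  obtain ⟨g, _, rfl⟩ := hi
  rfl

theorem layerMap_update (C : RandomCircuit n L) (N : Op1 →ₗ[ℂ] Op1)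
    {ℓ : Fin L} {i : C.GateIdx} (hi : i.1 ≠ ℓ) (v : C.GateIdx → U (Fin 2 × Fin 2))
    (x : U (Fin 2 × Fin 2)) (A : Op n) :
    C.layerMap N (Function.update v i x) ℓ A = C.layerMap N v ℓ A := by
  rw [layerMap, applyGates_update _ (fun h => hi (C.fst_of_mem_layerGates h)), layerMap]

theorem evolve_update (C : RandomCircuit n L) (N : Op1 →ₗ[ℂ] Op1)
    {ls : List (Fin L)} {i : C.GateIdx} (hi : i.1 ∉ ls) (v : C.GateIdx → U (Fin 2 × Fin 2))
    (x : U (Fin 2 × Fin 2)) (A : Op n) :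
    C.evolve N (Function.update v i x) ls A = C.evolve N v ls A := by
  induction ls generalizing A with
  | nil => simp only [evolve, List.foldl_nil]
  | cons ℓ ls ih =>
    simp only [List.mem_cons, not_or] at hi
    simp only [evolve, List.foldl_cons] at ih ⊢
    rw [layerMap_update C N hi.1, ih hi.2]

/-- The gates turn the bound on support averages into a pointwise one and decorrelate every qubit;
the noise followed by support averaging then gains one factor per non-identity letter. -/
theorem supportAvg_layerMap_le (C : RandomCircuit n L) {N : Op1 →ₗ[ℂ] Op1}
    (hN : ∀ r, pauliTransfer N 0 r = if r = 0 then 1 else 0) (ℓ : Fin L)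
    {B : (C.GateIdx → U (Fin 2 × Fin 2)) → Op n} (hB : Continuous B)
    (hi : ∀ i : C.GateIdx, i.1 = ℓ → ∀ v x, B (Function.update v i x) = B v) {β : ℝ}
    (hβ : ∀ Q, supportAvg (pauliMoment (Measure.pi C.gateLaw) B) Q ≤ β) (Q : Fin n → Fin 4) :
    supportAvg (pauliMoment (Measure.pi C.gateLaw) fun v => C.layerMap N v ℓ (B v)) Q ≤
      noiseConst N ^ pauliWeight Q * β := by
  have := fun i => (C.gateLaw_design i).isProb
  have hsite : ∀ i : C.GateIdx, (C.gateSite i).1 ≠ (C.gateSite i).2 := fun i => C.site_ne i.1 i.2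
  -- No decorrelation of the input is assumed: coverage of all qubits by this layer alone supplies
  -- it.
  obtain ⟨h1, h2⟩ := moments_applyGates (D := fun _ => False) C.gateLaw_design hsite
    (C.nodup_layerGates ℓ) hB (fun i hi' => hi i (C.fst_of_mem_layerGates hi'))
    (fun _ _ _ h => h.elim)
  have hcov : ∀ k, ∃ i ∈ C.layerGates ℓ, k = (C.gateSite i).1 ∨ k = (C.gateSite i).2 := by
    intro k
    obtain ⟨g, hg⟩ := C.covers ℓ k
    exact ⟨⟨ℓ, g⟩, by simp [layerGates], hg⟩
  have h3 := pauliMoment_noiseLayer N (Measure.pi C.gateLaw) (continuous_applyGates _ _ hB)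
    (fun Q R k _ => h2 Q R k (Or.inr (hcov k)))
  unfold layerMap
  rw [h3, h1]
  exact supportAvg_noiseStep_le hN (fun R => foldl_gateStep_le hsite hcov hβ R) Q

theorem trace_noiseLayer {N : Op1 →ₗ[ℂ] Op1}
    (hN : ∀ r, pauliTransfer N 0 r = if r = 0 then 1 else 0) (A : Op n) :
    (noiseLayer n N A).trace = A.trace := by
  rw [← pauliCoeff_zero, pauliCoeff_noiseLayer, Finset.sum_eq_single 0, pauliCoeff_zero]
  · simp [hN]
  · intro R _ hR
    obtain ⟨k, hk⟩ := Function.ne_iff.mp hR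
    rw [Finset.prod_eq_zero (Finset.mem_univ k), zero_mul]
    simpa [hN] using hk
  · simp

theorem trace_gateConj {ab : Fin n × Fin n} (hab : ab.1 ≠ ab.2) (u : U (Fin 2 × Fin 2))
    (A : Op n) : (gateConj ab u A).trace = A.trace := by
  rw [← pauliCoeff_zero, gateConj, pauliCoeff_gate_conj hab, Finset.sum_eq_single (0, 0),
    ← pauliCoeff_zero]
  · simp only [Pi.zero_apply]
    rw [isPauliFrame_pauliPair.frameTransfer_left_zero (Matrix.unitary_conjTranspose_mul u),
      if_pos rfl, one_mul]
    congr 1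
    exact setPair_self 0 _ _
  · intro s _ hs
    simp only [Pi.zero_apply]
    rw [isPauliFrame_pauliPair.frameTransfer_left_zero (Matrix.unitary_conjTranspose_mul u),
      if_neg hs, zero_mul]
  · simp

/-- The identity coefficient is the one the noise does not contract; trace preservation keeps it at
zero for traceless inputs. -/
theorem trace_layerMap (C : RandomCircuit n L) {N : Op1 →ₗ[ℂ] Op1}
    (hN : ∀ r, pauliTransfer N 0 r = if r = 0 then 1 else 0) (ℓ : Fin L)
    (v : C.GateIdx → U (Fin 2 × Fin 2)) (A : Op n) : (C.layerMap N v ℓ A).trace = A.trace := by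
  rw [layerMap, trace_noiseLayer hN]
  induction C.layerGates ℓ generalizing A with
  | nil => rfl
  | cons i gs ih =>
    rw [applyGates, List.foldl_cons]
    exact (ih _).trans (trace_gateConj (C.site_ne i.1 i.2) _ _)

theorem trace_evolve (C : RandomCircuit n L) {N : Op1 →ₗ[ℂ] Op1}
    (hN : ∀ r, pauliTransfer N 0 r = if r = 0 then 1 else 0) (ls : List (Fin L))
    (v : C.GateIdx → U (Fin 2 × Fin 2)) (A : Op n) : (C.evolve N v ls A).trace = A.trace := by
  induction ls generalizing A with
  | nil => rfl
  | cons ℓ ls ih =>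
    exact (ih _).trans (C.trace_layerMap hN ℓ v A)

/-- Noisy layers preserve the bound one on support-averaged second moments. -/
theorem supportAvg_evolve_le_one (C : RandomCircuit n L) {N : Op1 →ₗ[ℂ] Op1}
    (hN : ∀ r, pauliTransfer N 0 r = if r = 0 then 1 else 0) (hc : noiseConst N ≤ 1)
    {ls : List (Fin L)} (hls : ls.Nodup)
    {B : (C.GateIdx → U (Fin 2 × Fin 2)) → Op n} (hB : Continuous B)
    (hi : ∀ i : C.GateIdx, i.1 ∈ ls → ∀ v x, B (Function.update v i x) = B v)
    (hβ : ∀ Q, supportAvg (pauliMoment (Measure.pi C.gateLaw) B) Q ≤ 1) (Q : Fin n → Fin 4) :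
    supportAvg (pauliMoment (Measure.pi C.gateLaw) fun v => C.evolve N v ls (B v)) Q ≤ 1 := by
  induction ls generalizing B with
  | nil => exact hβ Q
  | cons ℓ ls ih =>
    rw [List.nodup_cons] at hls
    refine ih hls.2 (B := fun v => C.layerMap N v ℓ (B v)) (C.continuous_layerMap N hB ℓ) (fun i him v x => ?_) fun R => ?_
    · have hne : i.1 ≠ ℓ := by rintro rfl; exact hls.1 him
      rw [hi i (List.mem_cons_of_mem _ him), layerMap_update C N hne]
    · refine (C.supportAvg_layerMap_le hN ℓ hB (fun i h => hi i (by simp [h])) hβ R).trans ?_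
      rw [mul_one]
      exact pow_le_one₀ (noiseConst_nonneg N) hc

/-- Every layer but the last contributes one factor c, uniformly in the string, and the last
contributes the full power c^|Q|; hence the exponent |Q| + (number of layers − 1). -/
theorem supportAvg_evolve_le (C : RandomCircuit n L) {N : Op1 →ₗ[ℂ] Op1}
    (hN : ∀ r, pauliTransfer N 0 r = if r = 0 then 1 else 0) (hc : noiseConst N ≤ 1)
    {ls : List (Fin L)} (hls : ls.Nodup) (hne : ls ≠ [])
    {B : (C.GateIdx → U (Fin 2 × Fin 2)) → Op n} (hB : Continuous B)
    (hi : ∀ i : C.GateIdx, i.1 ∈ ls → ∀ v x, B (Function.update v i x) = B v)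
    (htr : ∀ v, (B v).trace = 0) {β : ℝ} (hβ0 : 0 ≤ β)
    (hβ : ∀ Q, supportAvg (pauliMoment (Measure.pi C.gateLaw) B) Q ≤ β) (Q : Fin n → Fin 4) :
    supportAvg (pauliMoment (Measure.pi C.gateLaw) fun v => C.evolve N v ls (B v)) Q ≤
      β * noiseConst N ^ (pauliWeight Q + ls.length - 1) := by
  have hc0 := noiseConst_nonneg N
  induction ls generalizing B β with
  | nil => exact absurd rfl hne
  | cons ℓ ls ih =>
    rw [List.nodup_cons] at hls
    have h1 := C.supportAvg_layerMap_le hN ℓ hB (fun i h => hi i (by simp [h])) hβ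
    -- If no layers remain, this is the last one and its weight-dependent bound is kept.
    rcases List.eq_nil_or_concat ls with rfl | hcons
    · rw [mul_comm]
      exact h1 Q
    have hls0 : ls ≠ [] := by
      obtain ⟨a, b, rfl⟩ := hcons; simp
    have h2 : ∀ R, supportAvg (pauliMoment (Measure.pi C.gateLaw)
        fun v => C.layerMap N v ℓ (B v)) R ≤ noiseConst N * β := by
      intro R
      -- The identity moment is the squared trace, hence zero; any other string has weight at least
      -- one and so gains at least one factor c.
      by_cases hR : R = 0
      · subst hR
        rw [supportAvg_zero]
        have : pauliMoment (Measure.pi C.gateLaw) (fun v => C.layerMap N v ℓ (B v)) 0 = 0 := by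
          simp [pauliMoment, pauliCoeff_zero, C.trace_layerMap hN, htr]
        rw [this]
        positivity
      · refine (h1 R).trans (mul_le_mul_of_nonneg_right ?_ hβ0)
        have : pauliWeight R ≠ 0 := by
          obtain ⟨k, hk⟩ := Function.ne_iff.mp hR
          exact Finset.card_ne_zero_of_mem (a := k) (by simpa using hk)
        exact pow_le_of_le_one hc0 hc this
    have h3 := ih hls.2 hls0 (B := fun v => C.layerMap N v ℓ (B v)) (C.continuous_layerMap N hB ℓ) (fun i him v x => by
        have hne : i.1 ≠ ℓ := by rintro rfl; exact hls.1 him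
        rw [hi i (List.mem_cons_of_mem _ him), layerMap_update C N hne])
      (fun v => by rw [C.trace_layerMap hN, htr]) (by positivity) h2
    refine h3.trans (le_of_eq ?_)
    have hlen : 0 < ls.length := List.length_pos_iff.mpr hls0
    rw [List.length_cons, show pauliWeight Q + (ls.length + 1) - 1 =
      (pauliWeight Q + ls.length - 1) + 1 by omega, pow_succ]
    ring

theorem continuous_tensorOp {X : Type*} [TopologicalSpace X] {f : X → Fin n → Op1}
    (hf : ∀ k, Continuous fun x => f x k) : Continuous fun x => tensorOp (f x) := by
  refine continuous_matrix fun i j => ?_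
  simp only [tensorOp, Matrix.of_apply]
  exact continuous_finsetProd _ fun k _ => (hf k).matrix_elem _ _

/-- The final layer of random single-qubit gates averages over Pauli strings of equal support. -/
theorem integral_final_layer (C : RandomCircuit n L)
    {B : (C.GateIdx → U (Fin 2 × Fin 2)) → Op n} (hB : Continuous B) (P : Fin n → Fin 4) :
    Continuous (fun u : C.Gates => pauliCoeff P (tensorOp (fun q => (u.2 q).1) * B u.1 *
      (tensorOp fun q => (u.2 q).1).conjTranspose)) ∧
    ∫ u, ‖pauliCoeff P (tensorOp (fun q => (u.2 q).1) * B u.1 *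
      (tensorOp fun q => (u.2 q).1).conjTranspose)‖ ^ 2 ∂C.law =
      supportAvg (pauliMoment (Measure.pi C.gateLaw) B) P := by
  have := fun i => (C.gateLaw_design i).isProb
  have := fun q => (C.finalLaw_design q).isProb
  have hV : Continuous fun u : C.Gates => (tensorOp fun q => (u.2 q).1 : Op n) :=
    continuous_tensorOp fun k => by fun_prop
  refine ⟨by fun_prop, ?_⟩
  have h1 : ∀ u : C.Gates, ((‖pauliCoeff P (tensorOp (fun q => (u.2 q).1) * B u.1 *
      (tensorOp fun q => (u.2 q).1).conjTranspose)‖ ^ 2 : ℝ) : ℂ) =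
      ∑ R : Fin n → Fin 4, ∑ S : Fin n → Fin 4,
        (pauliCoeff R (B u.1) * star (pauliCoeff S (B u.1))) *
        ∏ k, (frameTransfer pauli (u.2 k).1 (P k) (R k) *
          frameTransfer pauli (u.2 k).1 (P k) (S k)) := by
    intro u
    rw [Complex.ofReal_pow, ← Complex.mul_conj']
    change _ * star _ = _
    rw [pauliCoeff_tensorOp_conj, star_sum, Finset.sum_mul_sum]
    refine Finset.sum_congr rfl fun R _ => Finset.sum_congr rfl fun S _ => ?_
    rw [star_mul', star_prod, Finset.prod_mul_distrib]
    simp only [isPauliFrame_pauli.star_frameTransfer]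
    ring
  have hc : ∀ R S : Fin n → Fin 4, Integrable (fun u : C.Gates =>
      (pauliCoeff R (B u.1) * star (pauliCoeff S (B u.1))) *
        ∏ k, (frameTransfer pauli (u.2 k).1 (P k) (R k) *
          frameTransfer pauli (u.2 k).1 (P k) (S k)))
      ((Measure.pi C.gateLaw).prod (Measure.pi C.finalLaw)) := by
    intro R S
    refine Continuous.integrable_of_compactSpace ?_
    fun_prop
  apply Complex.ofReal_injective
  rw [← integral_complex_ofReal]
  simp only [h1, law]
  rw [integral_finsetSum _ fun R _ => integrable_finsetSum _ fun S _ => hc R S]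
  simp only [supportAvg, Complex.ofReal_sum]
  refine Finset.sum_congr rfl fun R _ => ?_
  rw [integral_finsetSum _ fun S _ => hc R S]
  -- The final gates are independent of B and of each other, so the expectation factors over qubits
  -- and the one-qubit design orthogonality leaves only S = R.
  have h2 : ∀ S : Fin n → Fin 4, ∫ u : C.Gates, (pauliCoeff R (B u.1) * star (pauliCoeff S (B u.1))) *
        ∏ k, (frameTransfer pauli (u.2 k).1 (P k) (R k) *
          frameTransfer pauli (u.2 k).1 (P k) (S k))
      ∂((Measure.pi C.gateLaw).prod (Measure.pi C.finalLaw)) =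
      crossMoment (Measure.pi C.gateLaw) B R S *
        ∏ k, (if R k = S k then (frameWeight 0 (P k) (R k) : ℂ) else 0) := by
    intro S
    rw [integral_prod_mul (fun v => pauliCoeff R (B v) * star (pauliCoeff S (B v)))
      (fun w : Fin n → U (Fin 2) => ∏ k, (frameTransfer pauli (w k).1 (P k) (R k) *
          frameTransfer pauli (w k).1 (P k) (S k)))]
    congr 1
    rw [integral_fintype_prod_eq_prod (fun k (x : U (Fin 2)) =>
      frameTransfer pauli x.1 (P k) (R k) * frameTransfer pauli x.1 (P k) (S k))]
    refine Finset.prod_congr rfl fun k _ => ?_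
    rw [isPauliFrame_pauli.integral_design (C.finalLaw_design k)]
    simp
  simp only [h2]
  rw [Finset.sum_eq_single R]
  · rw [crossMoment_self]
    simp [mul_comm]
  · intro S _ hS
    obtain ⟨k, hk⟩ := Function.ne_iff.mp hS
    rw [Finset.prod_eq_zero (Finset.mem_univ k) (if_neg hk.symm), mul_zero]
  · simp

end RandomCircuit

/-! The contraction constant of a channel -/

theorem pauliTransfer_zero_left {N : Op1 →ₗ[ℂ] Op1} (hN : IsChannel N) (r : Fin 4) :
    pauliTransfer N 0 r = if r = 0 then 1 else 0 := by
  have := isPauliFrame_pauli.trace_eq r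
  simp only [Fintype.card_fin] at this
  rw [pauliTransfer, Matrix.of_apply, pauli_zero, one_mul, hN.tracePreserving, this]
  split_ifs <;> simp

theorem noiseConst_eq {N : Op1 →ₗ[ℂ] Op1} (hN : IsChannel N) :
    noiseConst N = (∑ q, ∑ r, ‖pauliTransfer N q r‖ ^ 2 - 1) / 3 := by
  rw [noiseConst, ← Finset.add_sum_erase Finset.univ
    (fun q => ∑ r, ‖pauliTransfer N q r‖ ^ 2) (Finset.mem_univ 0)]
  have : ∑ r, ‖pauliTransfer N 0 r‖ ^ 2 = 1 := by
    simp [pauliTransfer_zero_left hN, apply_ite]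
  rw [this]
  ring

/-- A real orthogonal matrix is an isometry on complex vectors; it is applied to the transfer
matrices of the unitaries on both sides of a normal form. -/
theorem sum_norm_sq_of_orthogonal {K : Type} [Fintype K] [DecidableEq K] {τ : K → K → ℂ}
    (hs : ∀ q p, star (τ q p) = τ q p)
    (ho : ∀ p p', ∑ q, τ q p * τ q p' = if p = p' then 1 else 0) (x : K → ℂ) :
    ∑ q, ‖∑ p, τ q p * x p‖ ^ 2 = ∑ p, ‖x p‖ ^ 2 := by
  apply Complex.ofReal_injective
  simp only [Complex.ofReal_sum, Complex.ofReal_pow, ← Complex.mul_conj']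
  change ∑ q, (∑ p, τ q p * x p) * star (∑ p, τ q p * x p) = ∑ p, x p * star (x p)
  have h : ∀ q, (∑ p, τ q p * x p) * star (∑ p, τ q p * x p) =
      ∑ p, ∑ p', (x p * star (x p')) * (τ q p * τ q p') := by
    intro q
    rw [star_sum, Finset.sum_mul_sum]
    refine Finset.sum_congr rfl fun p _ => Finset.sum_congr rfl fun p' _ => ?_
    rw [star_mul', hs]
    ring
  simp only [h]
  rw [Finset.sum_comm]
  refine Finset.sum_congr rfl fun p _ => ?_
  rw [Finset.sum_comm]
  simp [← Finset.mul_sum, ho]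

/-- In matrix form T(N) = τ(W) T(N') τ(V)ᵀ. -/
theorem pauliTransfer_conj {N N' : Op1 →ₗ[ℂ] Op1} {W V : U (Fin 2)}
    (h : ∀ A : Op1, N A = W.1 * N' (V.1.conjTranspose * A * V.1) * W.1.conjTranspose)
    (q r : Fin 4) :
    pauliTransfer N q r = ∑ p, frameTransfer pauli W.1 q p *
      ∑ s, frameTransfer pauli V.1 r s * pauliTransfer N' p s := by
  have h1 : (pauli q * (W.1 * N' (V.1.conjTranspose * pauli r * V.1) * W.1.conjTranspose)).trace =
      ((W.1.conjTranspose * pauli q * W.1) * N' (V.1.conjTranspose * pauli r * V.1)).trace := by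
    rw [← mul_assoc, Matrix.trace_mul_comm]
    simp only [mul_assoc]
  rw [pauliTransfer, Matrix.of_apply, h, h1, isPauliFrame_pauli.conj_eq_sum,
    isPauliFrame_pauli.conj_eq_sum, map_sum, Finset.sum_mul_sum]
  simp only [map_smul, Matrix.smul_mul, Matrix.mul_smul, Matrix.trace_sum, Matrix.trace_smul,
    smul_eq_mul, pauliTransfer, Matrix.of_apply, Finset.sum_div, Finset.mul_sum]
  refine Finset.sum_congr rfl fun p _ => Finset.sum_congr rfl fun s _ => ?_
  ring

/-- The full Frobenius norm of the transfer matrix is invariant under orthogonal factors, and the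
identity row of any channel contributes exactly one to it. Hence the constant depends on N alone and
can be read off any normal form. -/
theorem noiseConst_eq_contraction {N : Op1 →ₗ[ℂ] Op1} (hN : IsChannel N)
    {t D : EuclideanSpace ℝ (Fin 3)} (h : HasNormalForm N t D) :
    noiseConst N = contraction t D := by
  obtain ⟨W, V, N', hN', hT, hA⟩ := h
  have horth := fun w : U (Fin 2) => sum_norm_sq_of_orthogonal
    (isPauliFrame_pauli.star_frameTransfer w.1)
    (isPauliFrame_pauli.sum_frameTransfer_mul (Matrix.unitary_conjTranspose_mul w))
  have h1 : ∑ q, ∑ r, ‖pauliTransfer N q r‖ ^ 2 = ∑ q, ∑ r, ‖pauliTransfer N' q r‖ ^ 2 := by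
    simp only [pauliTransfer_conj hA]
    rw [Finset.sum_comm]
    simp only [horth W]
    rw [Finset.sum_comm]
    simp only [horth V]
  rw [noiseConst_eq hN, h1, ← noiseConst_eq hN', noiseConst, contraction,
    EuclideanSpace.real_norm_sq_eq, EuclideanSpace.real_norm_sq_eq, hT]
  congr 1
  rw [show (Finset.univ.erase 0 : Finset (Fin 4)) = {1, 2, 3} by decide]
  simp [normalTransfer, Fin.sum_univ_four, Fin.sum_univ_three]
  ring

/-! ### The Choi matrix, and why the constant is below one for non-unitary channels -/

/-- The Choi matrix of a map on one qubit. -/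
noncomputable def choi (N : Op1 →ₗ[ℂ] Op1) : Matrix (Fin 2 × Fin 2) (Fin 2 × Fin 2) ℂ :=
  Matrix.of fun x y => N (Matrix.single x.2 y.2 1) x.1 y.1

/-- The Choi matrix is N ⊗ id applied to the unnormalised maximally entangled projector. -/
theorem posSemidef_choi {N : Op1 →ₗ[ℂ] Op1} (hN : IsChannel N) : (choi N).PosSemidef := by
  have h := hN.completelyPositive 2 _ (Matrix.posSemidef_vecMulVec_self_star
    (fun x : Fin 2 × Fin 2 => if x.1 = x.2 then (1 : ℂ) else 0))
  convert h using 1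
  refine Matrix.ext fun x y => ?_
  simp only [choi, amplify, Matrix.of_apply]
  refine congrArg (fun A => N A x.1 y.1) (Matrix.ext fun a b => ?_)
  simp only [Matrix.single, Matrix.of_apply, Matrix.vecMulVec_apply, Pi.star_apply]
  by_cases h1 : x.2 = a <;> by_cases h2 : y.2 = b <;> simp [h1, h2, Ne.symm]

theorem trace_choi {N : Op1 →ₗ[ℂ] Op1} (hN : IsChannel N) : (choi N).trace = 2 := by
  have h : ∀ a : Fin 2, ∑ i, N (Matrix.single a a 1) i i = 1 := by
    intro a
    have := hN.tracePreserving (Matrix.single a a 1)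
    rw [Matrix.trace_single_eq_same] at this
    exact this
  simp only [Matrix.trace, Matrix.diag, choi, Matrix.of_apply, Fintype.sum_prod_type]
  rw [Finset.sum_comm]
  simp [h]

theorem sum_norm_trace_pauli_mul_sq (A : Op1) :
    ∑ q, ‖(pauli q * A).trace‖ ^ 2 = 2 * ∑ i, ∑ j, ‖A i j‖ ^ 2 := by
  have h1 := isPauliFrame_pauli.sum_trace_mul_trace A A.conjTranspose
  have h2 : ∀ q, (pauli q * A.conjTranspose).trace = star (pauli q * A).trace := by
    intro q
    rw [← Matrix.trace_conjTranspose, Matrix.conjTranspose_mul, pauli_conjTranspose,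
      Matrix.trace_mul_comm]
  have h3 : (A * A.conjTranspose).trace = ∑ i, ∑ j, (‖A i j‖ ^ 2 : ℂ) := by
    simp only [Matrix.trace, Matrix.diag, Matrix.mul_apply, Matrix.conjTranspose_apply]
    exact Finset.sum_congr rfl fun i _ => Finset.sum_congr rfl fun j _ => Complex.mul_conj' _
  simp only [h2, h3] at h1
  apply Complex.ofReal_injective
  push_cast
  refine Eq.trans (Finset.sum_congr rfl fun q _ => (Complex.mul_conj' _).symm) (h1.trans ?_)
  simp

/-- Both sides are the squared Hilbert–Schmidt norm of N as a map on operators, computed in matrix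
units and in normalised Paulis. -/
theorem sum_norm_choi_sq (N : Op1 →ₗ[ℂ] Op1) :
    ∑ x, ∑ y, ‖choi N x y‖ ^ 2 = ∑ q, ∑ r, ‖pauliTransfer N q r‖ ^ 2 := by
  have h1 : ∀ x : Fin 4 → ℂ, ∑ b, ∑ a, ‖∑ s, x s * pauli s b a‖ ^ 2 = 2 * ∑ s, ‖x s‖ ^ 2 := by
    intro x
    have h := sum_norm_trace_pauli_mul_sq (∑ s, x s • pauli s)
    have h2 : ∀ q, (pauli q * ∑ s, x s • pauli s).trace = 2 * x q := by
      intro q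
      simp [Finset.mul_sum, Matrix.trace_sum, pauli_trace_mul, mul_comm]
    simp only [h2, Matrix.sum_apply, Matrix.smul_apply, smul_eq_mul, norm_mul, mul_pow,
      ← Finset.mul_sum] at h
    rw [show ‖(2 : ℂ)‖ ^ 2 = 4 by norm_num] at h
    linarith
  have h2 : 2 * ∑ x, ∑ y, ‖choi N x y‖ ^ 2 =
      ∑ a, ∑ b, 2 * ∑ i, ∑ j, ‖N (Matrix.single a b 1) i j‖ ^ 2 := by
    simp only [choi, Matrix.of_apply, Fintype.sum_prod_type, ← Finset.mul_sum]
    congr 1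
    rw [Finset.sum_comm]
    refine Finset.sum_congr rfl fun a _ => ?_
    rw [Finset.sum_comm]
    conv_lhs => enter [2, y]; rw [Finset.sum_comm]
    rw [Finset.sum_comm]
    conv_lhs => enter [2, y]; rw [Finset.sum_comm]
  have h3 : 2 * ∑ x, ∑ y, ‖choi N x y‖ ^ 2 = 2 * ∑ q, ∑ r, ‖pauliTransfer N q r‖ ^ 2 := by
    rw [h2]
    simp only [← sum_norm_trace_pauli_mul_sq, trace_pauli_mul_channel_single]
    rw [Finset.sum_comm]
    conv_lhs => enter [2, b]; rw [Finset.sum_comm]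
    rw [Finset.sum_comm, Finset.mul_sum]
    simp only [h1]
  linarith

open scoped MatrixOrder Matrix.Norms.L2Operator in
theorem _root_.Matrix.PosSemidef.exists_conjTranspose_mul_self {ι : Type} [Fintype ι]
    [DecidableEq ι] {J : Matrix ι ι ℂ} (hJ : J.PosSemidef) :
    ∃ B : Matrix ι ι ℂ, J = B.conjTranspose * B :=
  CStarAlgebra.nonneg_iff_eq_star_mul_self.mp hJ.nonneg

/-- A positive semidefinite matrix whose purity is the square of its trace has rank one. -/
theorem _root_.Matrix.PosSemidef.exists_vec_of_purity {ι : Type} [Fintype ι] [DecidableEq ι]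
    {J : Matrix ι ι ℂ} (hJ : J.PosSemidef) (h0 : J.trace ≠ 0)
    (hp : ‖J.trace‖ ^ 2 ≤ ∑ x, ∑ y, ‖J x y‖ ^ 2) :
    ∃ k : ι → ℂ, ∀ x y, J x y = k x * star (k y) := by
  obtain ⟨B, rfl⟩ := hJ.exists_conjTranspose_mul_self
  -- J is the Gram matrix of the columns of B. Maximal purity forces equality in Cauchy–Schwarz for
  -- every pair, so all columns are multiples of one nonzero column.
  let b : ι → EuclideanSpace ℂ ι := fun x => WithLp.toLp 2 fun i => B i x
  have hin : ∀ x y, (B.conjTranspose * B) x y = inner ℂ (b x) (b y) := by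
    intro x y
    simp [b, Matrix.mul_apply, PiLp.inner_apply, mul_comm]
  have hdiag : ∀ x, (B.conjTranspose * B) x x = ((‖b x‖ ^ 2 : ℝ) : ℂ) := by
    intro x
    rw [hin, inner_self_eq_norm_sq_to_K]
    push_cast
    rfl
  have htr : (B.conjTranspose * B).trace = ((∑ x, ‖b x‖ ^ 2 : ℝ) : ℂ) := by
    simp only [Matrix.trace, Matrix.diag, hdiag, Complex.ofReal_sum]
  have hle : ∀ x y, ‖(B.conjTranspose * B) x y‖ ^ 2 ≤ ‖b x‖ ^ 2 * ‖b y‖ ^ 2 := by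
    intro x y
    rw [hin, ← mul_pow]
    exact pow_le_pow_left₀ (norm_nonneg _) (norm_inner_le_norm _ _) 2
  have hsum : ‖(B.conjTranspose * B).trace‖ ^ 2 = ∑ x, ∑ y, ‖b x‖ ^ 2 * ‖b y‖ ^ 2 := by
    rw [htr, Complex.norm_real, Real.norm_eq_abs, sq_abs, sq, Finset.sum_mul_sum]
  have heq : ∀ x y, ‖(B.conjTranspose * B) x y‖ ^ 2 = ‖b x‖ ^ 2 * ‖b y‖ ^ 2 := by
    intro x y
    by_contra hne
    have hlt := lt_of_le_of_ne (hle x y) hne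
    have : ∑ x, ∑ y, ‖(B.conjTranspose * B) x y‖ ^ 2 < ∑ x, ∑ y, ‖b x‖ ^ 2 * ‖b y‖ ^ 2 :=
      Finset.sum_lt_sum (fun x _ => Finset.sum_le_sum fun y _ => hle x y)
        ⟨x, Finset.mem_univ x, Finset.sum_lt_sum (fun y _ => hle x y)
          ⟨y, Finset.mem_univ y, hlt⟩⟩
    rw [hsum] at hp
    exact absurd hp (not_le.mpr this)
  obtain ⟨x0, hx0⟩ : ∃ x, b x ≠ 0 := by
    by_contra hall
    push Not at hall
    exact h0 (by rw [htr]; simp [hall])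
  have hpar : ∀ y, ∃ r : ℂ, b y = r • b x0 := by
    intro y
    by_cases hy : b y = 0
    · exact ⟨0, by simp [hy]⟩
    · have h1 : ‖inner ℂ (b x0) (b y)‖ = ‖b x0‖ * ‖b y‖ := by
        have := heq x0 y
        rw [hin, ← mul_pow] at this
        exact (pow_left_inj₀ (norm_nonneg _) (by positivity) two_ne_zero).mp this
      obtain ⟨r, _, hr⟩ := (norm_inner_eq_norm_iff hx0 hy).mp h1
      exact ⟨r, hr⟩
  choose r hr using hpar
  refine ⟨fun x => star (r x) * (‖b x0‖ : ℂ), fun x y => ?_⟩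
  rw [hin, hr x, hr y, inner_smul_left, inner_smul_right, inner_self_eq_norm_sq_to_K]
  simp only [star_mul', RCLike.star_def, Complex.conj_conj, Complex.conj_ofReal, Complex.coe_algebraMap]
  ring

/-- A constant of at least one means that the Choi matrix has purity at least 4 = (Tr J)², hence
rank one. Its vector reshapes into a single Kraus operator, and trace preservation reads W†W = 1. -/
theorem isUnitaryChannel_of_one_le_noiseConst {N : Op1 →ₗ[ℂ] Op1} (hN : IsChannel N)
    (h : 1 ≤ noiseConst N) : IsUnitaryChannel N := by
  have hp : ‖(choi N).trace‖ ^ 2 ≤ ∑ x, ∑ y, ‖choi N x y‖ ^ 2 := by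
    rw [sum_norm_choi_sq, trace_choi hN]
    rw [noiseConst_eq hN] at h
    norm_num
    linarith
  obtain ⟨k, hk⟩ := (posSemidef_choi hN).exists_vec_of_purity (by rw [trace_choi hN]; simp) hp
  let W : Op1 := Matrix.of fun i a => k (i, a)
  have hW : ∀ A : Op1, N A = W * A * W.conjTranspose := by
    intro A
    conv_lhs => rw [Matrix.matrix_eq_sum_single A]
    ext i j
    have hs : ∀ a b, N (Matrix.single a b (A a b)) i j = k (i, a) * A a b * star (k (j, b)) := by
      intro a b
      have := hk (i, a) (j, b)
      simp only [choi, Matrix.of_apply] at this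
      rw [show Matrix.single a b (A a b) = A a b • Matrix.single a b (1 : ℂ) by
        rw [Matrix.smul_single, smul_eq_mul, mul_one], map_smul, Matrix.smul_apply, this,
        smul_eq_mul]
      ring
    simp only [map_sum, Matrix.sum_apply, hs, Matrix.mul_apply, W, Matrix.of_apply,
      Matrix.conjTranspose_apply, Finset.sum_mul]
    rw [Finset.sum_comm]
  have hU : W.conjTranspose * W = 1 := by
    ext a b
    have h1 := hN.tracePreserving (Matrix.single b a 1)
    rw [hW, Matrix.trace_mul_comm, ← mul_assoc, Matrix.trace_mul_single] at h1
    simp only [MulOpposite.op_one, one_smul] at h1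
    rw [h1, Matrix.one_apply]
    by_cases hab : a = b
    · subst hab; simp
    · rw [if_neg hab, Matrix.trace_single_eq_of_ne _ _ _ (Ne.symm hab)]
  exact ⟨⟨W, Matrix.mem_unitaryGroup_iff'.mpr hU⟩, hW⟩

/-! Existence of the normal form -/

/-- Positivity already yields Hermiticity: a Pauli operator is the difference of the positive
operators 1 + pauli q and 1, the former being half its own square. -/
theorem IsChannel.conjTranspose_apply_pauli {N : Op1 →ₗ[ℂ] Op1} (hN : IsChannel N) (q : Fin 4) :
    (N (pauli q)).conjTranspose = N (pauli q) := by
  have hpos : ∀ A : Op1, A.PosSemidef → (N A).IsHermitian := by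
    intro A hA
    have h := hN.completelyPositive 1 _ (hA.submatrix (Prod.fst : Fin 2 × Fin 1 → Fin 2))
    exact (h.submatrix (fun i : Fin 2 => (i, (0 : Fin 1)))).1
  have h1 : (N 1).conjTranspose = N 1 := hpos 1 Matrix.PosSemidef.one
  have h2 : (1 + pauli q).PosSemidef := by
    have h3 : 1 + pauli q = (1 / 2 : ℂ) • ((1 + pauli q).conjTranspose * (1 + pauli q)) := by
      rw [Matrix.conjTranspose_add, pauli_conjTranspose, Matrix.conjTranspose_one, add_mul, mul_add,
        mul_add, pauli_mul_self]
      simp only [one_mul, mul_one]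
      module
    rw [h3]
    exact (Matrix.posSemidef_conjTranspose_mul_self _).smul (by
      rw [Complex.le_def]; norm_num)
  have h3 : (N (1 + pauli q)).conjTranspose = N (1 + pauli q) := hpos _ h2
  rw [map_add, Matrix.conjTranspose_add, h1] at h3
  exact add_left_cancel h3

theorem IsChannel.star_pauliTransfer {N : Op1 →ₗ[ℂ] Op1} (hN : IsChannel N) (q r : Fin 4) :
    star (pauliTransfer N q r) = pauliTransfer N q r := by
  simp only [pauliTransfer, Matrix.of_apply]
  rw [star_div₀, ← Matrix.trace_conjTranspose, Matrix.conjTranspose_mul, pauli_conjTranspose,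
    hN.conjTranspose_apply_pauli, Matrix.trace_mul_comm]
  simp

theorem IsChannel.ofReal_re_pauliTransfer {N : Op1 →ₗ[ℂ] Op1} (hN : IsChannel N) (q r : Fin 4) :
    ((pauliTransfer N q r).re : ℂ) = pauliTransfer N q r :=
  Complex.conj_eq_iff_re.mp (hN.star_pauliTransfer q r)

/-- The map `A ↦ W† N(V A V†) W`. -/
noncomputable def conjMap (N : Op1 →ₗ[ℂ] Op1) (W V : Op1) : Op1 →ₗ[ℂ] Op1 where
  toFun A := W.conjTranspose * N (V * A * V.conjTranspose) * W
  map_add' A B := by simp [mul_add, add_mul]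
  map_smul' c A := by simp

theorem kronecker_one_conj_apply {d : ℕ} (V : Op1)
    (S : Matrix (Fin 2 × Fin d) (Fin 2 × Fin d) ℂ) (x y : Fin 2 × Fin d) :
    (Matrix.kronecker V (1 : Matrix (Fin d) (Fin d) ℂ) * S *
      (Matrix.kronecker V (1 : Matrix (Fin d) (Fin d) ℂ)).conjTranspose) x y =
    (V * (Matrix.of fun a b => S (a, x.2) (b, y.2)) * V.conjTranspose) x.1 y.1 := by
  simp only [Matrix.mul_apply, Matrix.conjTranspose_apply, Matrix.kronecker,
    Matrix.kroneckerMap_apply, Fintype.sum_prod_type, Matrix.one_apply, Matrix.of_apply,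
    mul_ite, mul_one, mul_zero, ite_mul, zero_mul, Finset.sum_ite_eq, Finset.mem_univ, if_true,
    apply_ite star, star_zero]

theorem IsChannel.conjMap {N : Op1 →ₗ[ℂ] Op1} (hN : IsChannel N) (W V : U (Fin 2)) :
    IsChannel (conjMap N W.1 V.1) where
  completelyPositive d S hS := by
    have h1 := hN.completelyPositive d _ (hS.mul_mul_conjTranspose_same
      (Matrix.kronecker V.1 (1 : Matrix (Fin d) (Fin d) ℂ)))
    have h2 := h1.mul_mul_conjTranspose_same
      (Matrix.kronecker W.1.conjTranspose (1 : Matrix (Fin d) (Fin d) ℂ))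
    convert h2 using 1
    refine Matrix.ext fun x y => ?_
    rw [kronecker_one_conj_apply, Matrix.conjTranspose_conjTranspose]
    simp only [amplify, Matrix.of_apply, NoisyCircuit.conjMap, LinearMap.coe_mk, AddHom.coe_mk]
    simp only [kronecker_one_conj_apply]
    rfl
  tracePreserving A := by
    change (W.1.conjTranspose * N (V.1 * A * V.1.conjTranspose) * W.1).trace = A.trace
    rw [Matrix.trace_mul_comm, ← mul_assoc, Matrix.unitary_mul_conjTranspose, one_mul,
      hN.tracePreserving, Matrix.trace_mul_comm, ← mul_assoc, Matrix.unitary_conjTranspose_mul,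
      one_mul]

/-! ### Bloch vectors, unitaries and singular values -/

/-- The observable `x · (X, Y, Z)`. -/
noncomputable def blochOp (x : Fin 3 → ℝ) : Op1 := ∑ i, (x i : ℂ) • pauli i.succ

theorem blochOp_eq (x : Fin 3 → ℝ) :
    blochOp x = !![(x 2 : ℂ), x 0 - Complex.I * x 1; x 0 + Complex.I * x 1, -(x 2 : ℂ)] := by
  ext i j
  fin_cases i <;> fin_cases j <;>
    simp [blochOp, Fin.sum_univ_three, pauli, Matrix.add_apply, Fin.succ] <;> ring

/-- Orthonormal Bloch vectors thus become anticommuting reflections, and the third axis is recovered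
from a cross product. -/
theorem blochOp_mul (x y : Fin 3 → ℝ) :
    blochOp x * blochOp y =
      ((x ⬝ᵥ y : ℝ) : ℂ) • (1 : Op1) + Complex.I • blochOp (crossProduct x y) := by
  have hI : Complex.I ^ 2 = -1 := Complex.I_sq
  rw [blochOp_eq, blochOp_eq, blochOp_eq]
  ext i j
  fin_cases i <;> fin_cases j <;>
    simp [Matrix.mul_apply, dotProduct, Fin.sum_univ_three, cross_apply] <;>
    ring_nf <;> simp only [hI] <;> ring

theorem conjTranspose_blochOp (x : Fin 3 → ℝ) : (blochOp x).conjTranspose = blochOp x := by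
  simp only [blochOp, Matrix.conjTranspose_sum, Matrix.conjTranspose_smul, pauli_conjTranspose]
  simp

/-- Two anticommuting reflections on a qubit are simultaneously conjugate to `X` and `Z`. -/
theorem exists_unitary_of_anticomm {a c : Op1} (ha : a.conjTranspose = a)
    (hc : c.conjTranspose = c) (ha2 : a * a = 1) (hc2 : c * c = 1) (hac : c * a = -(a * c)) :
    ∃ W : U (Fin 2), W.1 * pauli 1 * W.1.conjTranspose = a ∧
      W.1 * pauli 3 * W.1.conjTranspose = c := by
  -- Otherwise c = −1 would commute with a, forcing a = 0. A nonzero column of 1 + c is then a +1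
  -- eigenvector of c.
  have hne : 1 + c ≠ 0 := by
    intro h
    have h1 : c = -1 := (neg_eq_of_add_eq_zero_right h).symm
    rw [h1] at hac
    have h2 : a = 0 := by
      have h3 : a + a = 0 := by
        have : -a = a := by simpa using hac
        nth_rewrite 1 [← this]
        simp
      have h4 : (2 : ℂ) • a = 0 := by rw [two_smul, h3]
      simpa using h4
    rw [h2] at ha2
    simp at ha2
  obtain ⟨k, hk⟩ : ∃ k, ∃ i, (1 + c) i k ≠ 0 := by
    by_contra h
    push Not at h
    exact hne (Matrix.ext fun i k => h k i)
  -- The columns are that eigenvector and its image under a, a −1 eigenvector of c. In this pair a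
  -- and c act as X and Z.
  let M : Op1 := Matrix.of fun i j => if j = 0 then (1 + c) i k else (a * (1 + c)) i k
  have hcM : c * M = M * pauli 3 := by
    have e1 : c * (1 + c) = 1 + c := by rw [mul_add, hc2, mul_one, add_comm]
    have e2 : c * (a * (1 + c)) = -(a * (1 + c)) := by
      rw [← mul_assoc, hac, neg_mul, mul_assoc, e1]
    ext i j
    have f1 := congrFun (congrFun e1 i) k
    have f2 := congrFun (congrFun e2 i) k
    rw [Matrix.mul_apply] at f1 f2
    fin_cases j
    · simpa [M, Matrix.mul_apply, pauli] using f1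
    · simpa [M, Matrix.mul_apply, pauli] using f2
  have haM : a * M = M * pauli 1 := by
    have e2 : a * (a * (1 + c)) = 1 + c := by
      rw [← mul_assoc, ha2, one_mul]
    ext i j
    have f2 := congrFun (congrFun e2 i) k
    rw [Matrix.mul_apply] at f2
    fin_cases j
    · simp [M, Matrix.mul_apply, pauli]
    · simpa [M, Matrix.mul_apply, pauli] using f2
  -- M†M commutes with X and Z, so it is a scalar, and rescaling M gives a unitary.
  have hcomm : ∀ (m : Op1) (q : Fin 4), m.conjTranspose = m → m * M = M * pauli q →
      M.conjTranspose * M * pauli q = pauli q * (M.conjTranspose * M) := by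
    intro m q hm hmM
    rw [mul_assoc, ← hmM, ← mul_assoc, ← mul_assoc]
    congr 1
    have := congrArg Matrix.conjTranspose hmM
    rw [Matrix.conjTranspose_mul, Matrix.conjTranspose_mul, hm, pauli_conjTranspose] at this
    exact this
  have h3 := hcomm c 3 hc hcM
  have h1 := hcomm a 1 ha haM
  set H := M.conjTranspose * M with hH
  have hoff : H 0 1 = 0 ∧ H 1 0 = 0 := by
    have e1 := congrFun (congrFun h3 0) 1
    have e2 := congrFun (congrFun h3 1) 0
    simp [Matrix.mul_apply, pauli] at e1 e2
    constructor
    · linear_combination (-1 / 2 : ℂ) * e1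
    · linear_combination (1 / 2 : ℂ) * e2
  have hdiag : H 0 0 = H 1 1 := by
    have e1 := congrFun (congrFun h1 0) 1
    simpa [Matrix.mul_apply, pauli] using e1
  obtain ⟨r, hr0, hr⟩ : ∃ r : ℝ, 0 < r ∧ H 0 0 = (r : ℂ) := by
    refine ⟨∑ i, ‖M i 0‖ ^ 2, ?_, ?_⟩
    · obtain ⟨i, hi⟩ := hk
      refine Finset.sum_pos' (fun i _ => sq_nonneg _) ⟨i, Finset.mem_univ i, ?_⟩
      have : M i 0 ≠ 0 := by simpa [M] using hi
      positivity
    · rw [hH, Matrix.mul_apply]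
      push_cast
      exact Finset.sum_congr rfl fun i _ => by
        rw [Matrix.conjTranspose_apply]; exact Complex.conj_mul' _
  have hH1 : H = (r : ℂ) • (1 : Op1) := by
    ext i j
    fin_cases i <;> fin_cases j <;> simp [hoff, ← hdiag, hr]
  have hsq : ((Real.sqrt r : ℝ) : ℂ)⁻¹ * ((Real.sqrt r : ℝ) : ℂ)⁻¹ * r = 1 := by
    rw [← mul_inv, ← Complex.ofReal_mul, Real.mul_self_sqrt hr0.le]
    exact inv_mul_cancel₀ (by exact_mod_cast hr0.ne')
  set s : ℂ := ((Real.sqrt r : ℝ) : ℂ)⁻¹ with hs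
  have hstar : star s = s := by simp [hs]
  have hU : (s • M).conjTranspose * (s • M) = 1 := by
    rw [Matrix.conjTranspose_smul, Matrix.smul_mul, Matrix.mul_smul, smul_smul, hstar, ← hH, hH1,
      smul_smul, hsq, one_smul]
  have hmem : s • M ∈ Matrix.unitaryGroup (Fin 2) ℂ := Matrix.mem_unitaryGroup_iff'.mpr hU
  have hU' : (s • M) * (s • M).conjTranspose = 1 := Matrix.mem_unitaryGroup_iff.mp hmem
  refine ⟨⟨s • M, hmem⟩, ?_, ?_⟩
  · change (s • M) * pauli 1 * (s • M).conjTranspose = a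
    rw [Matrix.smul_mul, ← haM, ← Matrix.mul_smul, mul_assoc, hU', mul_one]
  · change (s • M) * pauli 3 * (s • M).conjTranspose = c
    rw [Matrix.smul_mul, ← hcM, ← Matrix.mul_smul, mul_assoc, hU', mul_one]

/-- Every orthonormal basis of the Bloch space comes from a unitary, up to scalars. -/
theorem exists_unitary_of_orthonormalBasis
    (v : OrthonormalBasis (Fin 3) ℝ (EuclideanSpace ℝ (Fin 3))) :
    ∃ (W : U (Fin 2)) (ε : Fin 3 → ℝ), ∀ j : Fin 3,
      W.1 * pauli j.succ * W.1.conjTranspose = (ε j : ℂ) • blochOp (v j) := by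
  have hdot : ∀ i j, (v i).ofLp ⬝ᵥ (v j).ofLp = if i = j then 1 else 0 := by
    intro i j
    have := orthonormal_iff_ite.mp v.orthonormal j i
    rw [EuclideanSpace.inner_eq_star_dotProduct] at this
    simpa [eq_comm] using this
  have hsq : ∀ i, blochOp (v i) * blochOp (v i) = 1 := by
    intro i
    rw [blochOp_mul, hdot, cross_self]
    simp [blochOp]
  have hneg : ∀ x : Fin 3 → ℝ, blochOp (-x) = -blochOp x := by
    intro x; simp [blochOp]
  have hanti : blochOp (v 2) * blochOp (v 0) = -(blochOp (v 0) * blochOp (v 2)) := by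
    rw [blochOp_mul, blochOp_mul, hdot, hdot, ← cross_anticomm, hneg]
    simp
  obtain ⟨W, hX, hZ⟩ := exists_unitary_of_anticomm (conjTranspose_blochOp _)
    (conjTranspose_blochOp _) (hsq 0) (hsq 2) hanti
  have hY : pauli 2 = Complex.I • (pauli 1 * pauli 3) := by
    ext i j
    fin_cases i <;> fin_cases j <;> simp [pauli]
  -- The cross product is orthogonal to v 0 and v 2, hence a multiple e of v 1. The scalar e records
  -- the orientation of the basis; its value is not needed.
  have hcross : crossProduct (v 0).ofLp (v 2).ofLp =
      ((v 1).ofLp ⬝ᵥ crossProduct (v 0).ofLp (v 2).ofLp) • (v 1).ofLp := by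
    have h1 := v.sum_repr (WithLp.toLp 2 (crossProduct (v 0).ofLp (v 2).ofLp))
    simp only [Fin.sum_univ_three, OrthonormalBasis.repr_apply_apply,
      EuclideanSpace.inner_eq_star_dotProduct] at h1
    have h2 := congrArg WithLp.ofLp h1
    simp only [star_trivial, WithLp.ofLp_add, WithLp.ofLp_smul] at h2
    rw [dotProduct_comm _ (v 0).ofLp, dotProduct_comm _ (v 1).ofLp, dotProduct_comm _ (v 2).ofLp,
      dot_self_cross, dot_cross_self] at h2
    simpa using h2.symm
  set e := (v 1).ofLp ⬝ᵥ crossProduct (v 0).ofLp (v 2).ofLp with he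
  have hsmul : ∀ (r : ℝ) (x : Fin 3 → ℝ), blochOp (r • x) = (r : ℂ) • blochOp x := by
    intro r x
    simp only [blochOp, Finset.smul_sum, smul_smul, Pi.smul_apply, smul_eq_mul, Complex.ofReal_mul]
  -- From Y = iXZ, the image of Y is i · i times the cross product term, which gives −e.
  refine ⟨W, ![1, -e, 1], fun j => ?_⟩
  fin_cases j
  · simpa using hX
  · change W.1 * pauli 2 * W.1.conjTranspose = ((-e : ℝ) : ℂ) • blochOp (v 1)
    have h1 : W.1 * pauli 2 * W.1.conjTranspose = Complex.I • ((W.1 * pauli 1 * W.1.conjTranspose) *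
        (W.1 * pauli 3 * W.1.conjTranspose)) := by
      rw [hY, Matrix.mul_smul, Matrix.smul_mul]
      congr 1
      calc W.1 * (pauli 1 * pauli 3) * W.1.conjTranspose
          = W.1 * pauli 1 * 1 * (pauli 3 * W.1.conjTranspose) := by
            simp only [mul_assoc, one_mul]
        _ = _ := by
            rw [← Matrix.unitary_conjTranspose_mul W]; simp only [mul_assoc]
    rw [h1, hX, hZ, blochOp_mul, hdot, hcross, hsmul]
    simp only [Fin.reduceEq, if_false, Complex.ofReal_zero, zero_smul, zero_add, smul_smul]
    rw [← mul_assoc, Complex.I_mul_I]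
    simp
  · simpa using hZ

/-- Singular value decomposition of a real `3 × 3` matrix. -/
theorem exists_singularValueDecomposition (M : Matrix (Fin 3) (Fin 3) ℝ) :
    ∃ (u v : OrthonormalBasis (Fin 3) ℝ (EuclideanSpace ℝ (Fin 3))) (s : Fin 3 → ℝ),
      ∀ j, M.mulVec (v j).ofLp = s j • (u j).ofLp := by
  have hH : (M.transpose * M).IsHermitian := by
    have := Matrix.isHermitian_conjTranspose_mul_self M
    rwa [Matrix.conjTranspose_eq_transpose_of_trivial] at this
  set v := hH.eigenvectorBasis with hv
  let w : Fin 3 → EuclideanSpace ℝ (Fin 3) := fun j => WithLp.toLp 2 (M.mulVec (v j).ofLp)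
  have hw : ∀ i j, i ≠ j → inner ℝ (w i) (w j) = 0 := by
    intro i j hij
    have h1 : inner ℝ (w i) (w j) = (v i).ofLp ⬝ᵥ (M.transpose * M).mulVec (v j).ofLp := by
      rw [← Matrix.mulVec_mulVec, Matrix.dotProduct_mulVec, Matrix.vecMul_transpose,
        EuclideanSpace.inner_eq_star_dotProduct, dotProduct_comm]
      simp [w]
    rw [h1, hH.mulVec_eigenvectorBasis, dotProduct_smul]
    have := orthonormal_iff_ite.mp v.orthonormal i j
    rw [if_neg hij, EuclideanSpace.inner_eq_star_dotProduct, dotProduct_comm] at this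
    simp only [star_trivial] at this
    rw [← hv, this, smul_zero]
  -- The images under M of the eigenvectors of MᵀM are orthogonal. Normalising the nonzero ones and
  -- extending handles singular M, with singular value zero elsewhere.
  have horth : Orthonormal ℝ ({j | w j ≠ 0}.domRestrict fun j => (‖w j‖⁻¹ : ℝ) • w j) := by
    constructor
    · rintro ⟨j, hj⟩
      have : ‖w j‖ ≠ 0 := norm_ne_zero_iff.mpr hj
      change ‖(‖w j‖⁻¹ : ℝ) • w j‖ = 1
      simp [norm_smul, this]
    · rintro ⟨i, hi⟩ ⟨j, hj⟩ hij
      have : i ≠ j := fun h => hij (Subtype.ext h)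
      change inner ℝ ((‖w i‖⁻¹ : ℝ) • w i) ((‖w j‖⁻¹ : ℝ) • w j) = 0
      simp [inner_smul_left, inner_smul_right, hw i j this]
  obtain ⟨u, hu⟩ := horth.exists_orthonormalBasis_extension_of_card_eq (by simp)
  refine ⟨u, v, fun j => ‖w j‖, fun j => ?_⟩
  change (w j).ofLp = _
  by_cases hj : w j = 0
  · simp [hj]
  · rw [hu j hj, WithLp.ofLp_smul, smul_smul, mul_inv_cancel₀ (norm_ne_zero_iff.mpr hj), one_smul]

/-- The singular bases of the real Bloch block are realised by unitaries up to scalars. Conjugating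
N by them diagonalises the block, and the scalars are absorbed into D, whose entries may be
negative. -/
theorem exists_hasNormalForm {N : Op1 →ₗ[ℂ] Op1} (hN : IsChannel N) :
    ∃ t D : EuclideanSpace ℝ (Fin 3), HasNormalForm N t D := by
  let M : Matrix (Fin 3) (Fin 3) ℝ := Matrix.of fun i j => (pauliTransfer N i.succ j.succ).re
  have hM : ∀ i j : Fin 3, pauliTransfer N i.succ j.succ = (M i j : ℂ) := fun i j =>
    (hN.ofReal_re_pauliTransfer _ _).symm
  obtain ⟨u, v, s, hs⟩ := exists_singularValueDecomposition M
  obtain ⟨W, ε, hW⟩ := exists_unitary_of_orthonormalBasis u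
  obtain ⟨V, δ, hV⟩ := exists_unitary_of_orthonormalBasis v
  have hN' := hN.conjMap W V
  have hfirst := fun r => pauliTransfer_zero_left hN' r
  have hblock : ∀ i j : Fin 3, pauliTransfer (conjMap N W.1 V.1) i.succ j.succ =
      if i = j then ((ε j * δ j * s j : ℝ) : ℂ) else 0 := by
    intro i j
    have h1 : pauliTransfer (conjMap N W.1 V.1) i.succ j.succ =
        (W.1 * pauli i.succ * W.1.conjTranspose *
          N (V.1 * pauli j.succ * V.1.conjTranspose)).trace / 2 := by
      simp only [pauliTransfer, Matrix.of_apply, conjMap, LinearMap.coe_mk, AddHom.coe_mk]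
      rw [← mul_assoc, Matrix.trace_mul_comm]
      simp only [mul_assoc]
    have h2 : (u i).ofLp ⬝ᵥ M.mulVec (v j).ofLp = if i = j then s j else 0 := by
      have := orthonormal_iff_ite.mp u.orthonormal j i
      rw [EuclideanSpace.inner_eq_star_dotProduct] at this
      simp only [star_trivial] at this
      rw [hs, dotProduct_smul, this]
      by_cases hij : i = j
      · simp [hij]
      · simp [hij, Ne.symm hij]
    have h3 : (blochOp (u i) * N (blochOp (v j))).trace / 2 =
        (((u i).ofLp ⬝ᵥ M.mulVec (v j).ofLp : ℝ) : ℂ) := by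
      rw [blochOp, blochOp, map_sum, Finset.sum_mul_sum]
      simp only [map_smul, Matrix.trace_sum, Matrix.smul_mul,
        Matrix.mul_smul, Matrix.trace_smul, Finset.sum_div, dotProduct, Matrix.mulVec,
        Complex.ofReal_sum, Complex.ofReal_mul, Finset.mul_sum, ← hM, pauliTransfer,
        Matrix.of_apply, smul_eq_mul]
      refine Finset.sum_congr rfl fun a _ => Finset.sum_congr rfl fun b _ => ?_
      ring
    rw [h1, hW, hV, map_smul, Matrix.smul_mul, Matrix.mul_smul, Matrix.trace_smul,
      Matrix.trace_smul, smul_eq_mul, smul_eq_mul, mul_div_assoc, mul_div_assoc, h3, h2]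
    by_cases hij : i = j
    · subst hij
      simp
      ring
    · simp [hij]
  refine ⟨WithLp.toLp 2 fun i => (pauliTransfer (conjMap N W.1 V.1) i.succ 0).re,
    WithLp.toLp 2 fun i => ε i * δ i * s i, W, V, conjMap N W.1 V.1, hN', ?_, fun A => ?_⟩
  · ext q r
    refine Fin.cases ?_ (fun i => ?_) q
    · rw [hfirst]
      fin_cases r <;> simp [normalTransfer]
    · refine Fin.cases ?_ (fun j => ?_) r
      · rw [← hN'.ofReal_re_pauliTransfer]
        fin_cases i <;> simp [normalTransfer]
      · rw [hblock]
        fin_cases i <;> fin_cases j <;> simp [normalTransfer]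
  · have h1 : V.1 * (V.1.conjTranspose * A * V.1) * V.1.conjTranspose = A := by
      calc _ = (V.1 * V.1.conjTranspose) * A * (V.1 * V.1.conjTranspose) := by
            simp only [mul_assoc]
        _ = A := by rw [Matrix.unitary_mul_conjTranspose, one_mul, mul_one]
    simp only [conjMap, LinearMap.coe_mk, AddHom.coe_mk, h1]
    calc N A = (W.1 * W.1.conjTranspose) * N A * (W.1 * W.1.conjTranspose) := by
          rw [Matrix.unitary_mul_conjTranspose, one_mul, mul_one]
      _ = _ := by simp only [mul_assoc]

/-! Bounds for random circuits -/

namespace RandomCircuit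

variable {n L : ℕ}

instance instIsProbabilityMeasureLaw (C : RandomCircuit n L) : IsProbabilityMeasure C.law := by
  have := fun i => (C.gateLaw_design i).isProb
  have := fun q => (C.finalLaw_design q).isProb
  unfold law
  infer_instance

theorem mul_conj_sub (V A B : Op n) :
    V * A * V.conjTranspose - V * B * V.conjTranspose = V * (A - B) * V.conjTranspose := by
  rw [mul_sub, sub_mul]

/-- The input may be random provided that it does not involve the gates of the last l layers; this
generality covers both the full circuit and the truncation error. -/
theorem secondMoment_lastLayers_le (C : RandomCircuit n L) {N : Op1 →ₗ[ℂ] Op1}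
    (hN : ∀ r, pauliTransfer N 0 r = if r = 0 then 1 else 0) (hc : noiseConst N ≤ 1)
    {l : ℕ} (hl1 : 1 ≤ l) (hl : l ≤ L) {B : (C.GateIdx → U (Fin 2 × Fin 2)) → Op n}
    (hB : Continuous B)
    (hi : ∀ i : C.GateIdx, i.1 ∈ (List.finRange L).drop (L - l) →
      ∀ v x, B (Function.update v i x) = B v)
    (htr : ∀ v, (B v).trace = 0) {β : ℝ} (hβ0 : 0 ≤ β)
    (hβ : ∀ Q, supportAvg (pauliMoment (Measure.pi C.gateLaw) B) Q ≤ β) (P : Fin n → Fin 4) :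
    Continuous (fun u : C.Gates => pauliCoeff P (C.lastLayers N u l (B u.1))) ∧
    ∫ u, ‖pauliCoeff P (C.lastLayers N u l (B u.1))‖ ^ 2 ∂C.law ≤
      β * noiseConst N ^ (pauliWeight P + l - 1) := by
  set ls := (List.finRange L).drop (L - l) with hls
  have hlen : ls.length = l := by
    rw [hls, List.length_drop, List.length_finRange]; omega
  have hnd : ls.Nodup := (List.nodup_finRange L).sublist (List.drop_sublist _ _)
  have hne : ls ≠ [] := List.length_pos_iff.mp (by omega)
  obtain ⟨h1, h2⟩ := C.integral_final_layer (C.continuous_evolve N hB ls) P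
  have h3 := C.supportAvg_evolve_le hN hc hnd hne hB hi htr hβ0 hβ P
  simp only [lastLayers_eq]
  rw [hlen] at h3
  exact ⟨h1, h2.trans_le h3⟩

theorem pauliMoment_const (C : RandomCircuit n L) (A : Op n) (Q : Fin n → Fin 4) :
    pauliMoment (Measure.pi C.gateLaw) (fun _ => A) Q = ‖pauliCoeff Q A‖ ^ 2 := by
  have := fun i => (C.gateLaw_design i).isProb
  simp [pauliMoment]

theorem secondMoment_channel_sub_le (C : RandomCircuit n L) {N : Op1 →ₗ[ℂ] Op1}
    (hN : ∀ r, pauliTransfer N 0 r = if r = 0 then 1 else 0) (hc : noiseConst N ≤ 1)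
    (hL : 1 ≤ L) (P : Fin n → Fin 4) {ρ σ : Op n} (hρ : IsState ρ) (hσ : IsState σ) :
    Continuous (fun u : C.Gates => pauliCoeff P (C.channel N u (ρ - σ))) ∧
    ∫ u, ‖pauliCoeff P (C.channel N u (ρ - σ))‖ ^ 2 ∂C.law ≤
      4 * noiseConst N ^ (pauliWeight P + L - 1) := by
  refine C.secondMoment_lastLayers_le hN hc hL le_rfl (B := fun _ => ρ - σ) continuous_const
    (fun _ _ _ _ => rfl) (fun _ => ?_) (by norm_num) (supportAvg_le fun Q => ?_) P
  · rw [Matrix.trace_sub, hρ.trace_eq_one, hσ.trace_eq_one, sub_self]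
  · rw [pauliMoment_const, pauliCoeff_sub]
    -- Each coefficient is at most one in modulus, so the squared difference is at most (1 + 1)² =
    -- 4.
    have h1 := norm_sub_le (pauliCoeff Q ρ) (pauliCoeff Q σ)
    have h2 := norm_pauliCoeff_le_one hρ Q
    have h3 := norm_pauliCoeff_le_one hσ Q
    have h4 := norm_nonneg (pauliCoeff Q ρ - pauliCoeff Q σ)
    nlinarith

/-- By linearity the truncation error is the last l layers applied to "first layers of ρ, minus ρ".
This operator is traceless, depends only on earlier gates, and has support-averaged moments at most
2 + 2 = 4. -/
theorem secondMoment_channel_sub_lastLayers_le (C : RandomCircuit n L) {N : Op1 →ₗ[ℂ] Op1}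
    (hN : ∀ r, pauliTransfer N 0 r = if r = 0 then 1 else 0) (hc : noiseConst N ≤ 1)
    (P : Fin n → Fin 4) {ρ : Op n} (hρ : IsState ρ) {l : ℕ} (hl1 : 1 ≤ l) (hl : l ≤ L) :
    Continuous (fun u : C.Gates =>
      pauliCoeff P (C.channel N u ρ) - pauliCoeff P (C.lastLayers N u l ρ)) ∧
    ∫ u, ‖pauliCoeff P (C.channel N u ρ) - pauliCoeff P (C.lastLayers N u l ρ)‖ ^ 2 ∂C.law ≤
      4 * noiseConst N ^ (pauliWeight P + l - 1) := by
  have := fun i => (C.gateLaw_design i).isProb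
  set first := (List.finRange L).take (L - l) with hfirst
  have hX : Continuous fun v : C.GateIdx → U (Fin 2 × Fin 2) => C.evolve N v first ρ :=
    C.continuous_evolve N continuous_const first
  have heq : ∀ u : C.Gates,
      pauliCoeff P (C.channel N u ρ) - pauliCoeff P (C.lastLayers N u l ρ) =
      pauliCoeff P (C.lastLayers N u l (C.evolve N u.1 first ρ - ρ)) := by
    intro u
    rw [← pauliCoeff_sub, channel, lastLayers_eq, lastLayers_eq, lastLayers_eq, mul_conj_sub,
      evolve_sub, ← evolve_append, hfirst, List.take_append_drop, Nat.sub_self, List.drop_zero]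
  have hstate : ∀ Q, supportAvg (pauliMoment (Measure.pi C.gateLaw) fun _ => ρ) Q ≤ 1 :=
    supportAvg_le fun Q => by
      rw [pauliMoment_const]
      exact pow_le_one₀ (norm_nonneg _) (norm_pauliCoeff_le_one hρ Q)
  have hfirst1 : ∀ Q, supportAvg (pauliMoment (Measure.pi C.gateLaw)
      fun v => C.evolve N v first ρ) Q ≤ 1 :=
    C.supportAvg_evolve_le_one hN hc
      ((List.nodup_finRange L).sublist (List.take_sublist _ _)) (B := fun _ => ρ) continuous_const
      (fun _ _ _ _ => rfl) hstate
  -- Pointwise |a − b|² ≤ 2|a|² + 2|b|², used because the moments of the evolved state are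
  -- controlled only after support averaging.
  have hpt : ∀ Q, pauliMoment (Measure.pi C.gateLaw) (fun v => C.evolve N v first ρ - ρ) Q ≤
      2 * pauliMoment (Measure.pi C.gateLaw) (fun v => C.evolve N v first ρ) Q +
        2 * pauliMoment (Measure.pi C.gateLaw) (fun _ => ρ) Q := by
    intro Q
    have hint : ∀ {B : (C.GateIdx → U (Fin 2 × Fin 2)) → Op n}, Continuous B →
        Integrable (fun v => ‖pauliCoeff Q (B v)‖ ^ 2) (Measure.pi C.gateLaw) := by
      intro B hB
      refine Continuous.integrable_of_compactSpace ?_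
      fun_prop
    simp only [pauliMoment]
    rw [← integral_const_mul, ← integral_const_mul, ← integral_add ((hint hX).const_mul 2)
      ((hint continuous_const).const_mul 2)]
    refine integral_mono (hint (hX.sub continuous_const)) (((hint hX).const_mul 2).add
      ((hint continuous_const).const_mul 2)) fun v => ?_
    simp only [pauliCoeff_sub]
    have h1 := norm_sub_le (pauliCoeff Q (C.evolve N v first ρ)) (pauliCoeff Q ρ)
    have h4 := norm_nonneg (pauliCoeff Q (C.evolve N v first ρ) - pauliCoeff Q ρ)
    nlinarith [sq_nonneg (‖pauliCoeff Q (C.evolve N v first ρ)‖ - ‖pauliCoeff Q ρ‖)]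
  simp only [heq]
  refine C.secondMoment_lastLayers_le hN hc hl1 hl (B := fun v => C.evolve N v first ρ - ρ)
    (hX.sub continuous_const) (fun i him v x => ?_) (fun v => ?_) (by norm_num) (fun Q => ?_) P
  · have hnot : i.1 ∉ first := fun h =>
      List.disjoint_take_drop (List.nodup_finRange L) le_rfl h him
    rw [C.evolve_update N hnot]
  · rw [Matrix.trace_sub, C.trace_evolve hN, sub_self]
  · refine (supportAvg_mono hpt Q).trans ?_
    have hsplit : ∀ f g : (Fin n → Fin 4) → ℝ, supportAvg (fun Q => 2 * f Q + 2 * g Q) Q =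
        2 * supportAvg f Q + 2 * supportAvg g Q := by
      intro f g
      simp only [supportAvg, Finset.mul_sum, ← Finset.sum_add_distrib]
      exact Finset.sum_congr rfl fun R _ => by ring
    rw [hsplit]
    linarith [hstate Q, hfirst1 Q]

end RandomCircuit

/-! ### Exponential rates and first moments -/

/-- Half of the geometric decay is spent on absorbing the factor 4 and the shift by one; the other
half is the rate κ. -/
theorem exists_exp_bound {c : ℝ} (hc0 : 0 ≤ c) (hc1 : c < 1) :
    ∃ κ : ℝ, 0 < κ ∧ ∃ m₀ : ℕ, ∀ m : ℕ, m₀ ≤ m →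
      4 * c ^ (m - 1) ≤ Real.exp (-κ * (m : ℝ)) := by
  -- Keeps the logarithm meaningful when c = 0; x below is the square root of d.
  set d := max c (1 / 2) with hd
  have hd0 : 0 < d := lt_max_of_lt_right (by norm_num)
  have hd1 : d < 1 := max_lt hc1 (by norm_num)
  have hlog : Real.log d < 0 := Real.log_neg hd0 hd1
  set x := Real.exp (Real.log d / 2) with hx
  have hxx : x * x = d := by
    rw [hx, ← Real.exp_add, add_halves, Real.exp_log hd0]
  have hx0 : 0 < x := Real.exp_pos _
  have hx1 : x < 1 := by
    rw [hx, ← Real.exp_zero]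
    exact Real.exp_lt_exp.mpr (by linarith)
  obtain ⟨k, hk⟩ := exists_pow_lt_of_lt_one (show (0 : ℝ) < 1 / 4 by norm_num) hx1
  refine ⟨-(Real.log d / 2), by linarith, k + 2, fun m hm => ?_⟩
  obtain ⟨j, rfl⟩ := Nat.exists_eq_add_of_le hm
  rw [neg_neg, mul_comm (Real.log d / 2), Real.exp_nat_mul, ← hx]
  have h1 : c ^ (k + 2 + j - 1) ≤ (x * x) ^ (k + 1 + j) := by
    rw [hxx, show k + 2 + j - 1 = k + 1 + j by omega]
    exact pow_le_pow_left₀ hc0 (le_max_left _ _) _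
  have h2 : (x * x) ^ (k + 1 + j) = x ^ k * x ^ j * x ^ (k + 2 + j) := by
    ring
  have h3 : x ^ j ≤ 1 := pow_le_one₀ hx0.le hx1.le
  have h4 : 0 < x ^ (k + 2 + j) := by positivity
  have h5 : x ^ k * x ^ j ≤ 1 / 4 := by
    have := mul_le_mul hk.le h3 (by positivity) (by norm_num)
    linarith
  have h6 := mul_le_mul_of_nonneg_right h5 h4.le
  linarith

/-- A bound on the first moment from one on the second moment. -/
theorem integral_norm_le_of_integral_norm_sq_le {Ω : Type*} [MeasurableSpace Ω] {μ : Measure Ω}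
    [IsProbabilityMeasure μ] {f : Ω → ℂ} (hf : Integrable (fun u => ‖f u‖) μ)
    (hf2 : Integrable (fun u => ‖f u‖ ^ 2) μ) {δ : ℝ} (hδ : 0 < δ)
    (h : ∫ u, ‖f u‖ ^ 2 ∂μ ≤ δ ^ 2) : ∫ u, ‖f u‖ ∂μ ≤ δ := by
  -- The arithmetic–geometric mean inequality a ≤ a²/(2δ) + δ/2 replaces Jensen's inequality.
  have h1 : ∫ u, ‖f u‖ ∂μ ≤ ∫ u, ((1 / (2 * δ)) * ‖f u‖ ^ 2 + δ / 2) ∂μ := by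
    refine integral_mono hf ((hf2.const_mul _).add (integrable_const _)) fun u => ?_
    change ‖f u‖ ≤ (1 / (2 * δ)) * ‖f u‖ ^ 2 + δ / 2
    have h2 : (1 / (2 * δ)) * ‖f u‖ ^ 2 + δ / 2 - ‖f u‖ = (‖f u‖ - δ) ^ 2 / (2 * δ) := by
      field_simp
      ring
    have h3 : 0 ≤ (‖f u‖ - δ) ^ 2 / (2 * δ) := by positivity
    linarith
  rw [integral_add (hf2.const_mul _) (integrable_const _), integral_const_mul] at h1
  simp only [integral_const, probReal_univ, one_smul] at h1
  have h2 : (1 / (2 * δ)) * ∫ u, ‖f u‖ ^ 2 ∂μ ≤ (1 / (2 * δ)) * δ ^ 2 :=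
    mul_le_mul_of_nonneg_left h (by positivity)
  have h3 : (1 / (2 * δ)) * δ ^ 2 = δ / 2 := by field_simp
  linarith

end NoisyCircuit

/-! ### The main theorem -/

theorem mainTheorem1 (N : Op1 →ₗ[ℂ] Op1) (hN : IsChannel N) (hnu : ¬ IsUnitaryChannel N) :
    -- the noise has a normal form
    (∃ t D : EuclideanSpace ℝ (Fin 3), HasNormalForm N t D) ∧
    -- explicit bounds, for the constant of any normal form
    (∀ t D : EuclideanSpace ℝ (Fin 3), HasNormalForm N t D →
      contraction t D < 1 ∧
      ∀ (n L : ℕ), 1 ≤ L → ∀ (C : RandomCircuit n L) (P : Fin n → Fin 4),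
        (∀ ρ σ : Op n, IsState ρ → IsState σ →
          Integrable (fun u => ‖(pauliString P * C.channel N u (ρ - σ)).trace‖ ^ 2) C.law ∧
          ∫ u, ‖(pauliString P * C.channel N u (ρ - σ)).trace‖ ^ 2 ∂C.law
            ≤ 4 * contraction t D ^ (pauliWeight P + L - 1)) ∧
        (∀ ρ₀ : Op n, IsState ρ₀ → ∀ l : ℕ, 1 ≤ l → l ≤ L →
          Integrable (fun u => ‖(pauliString P * C.channel N u ρ₀).trace
            - (pauliString P * C.lastLayers N u l ρ₀).trace‖ ^ 2) C.law ∧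
          ∫ u, ‖(pauliString P * C.channel N u ρ₀).trace
            - (pauliString P * C.lastLayers N u l ρ₀).trace‖ ^ 2 ∂C.law
            ≤ 4 * contraction t D ^ (pauliWeight P + l - 1))) ∧
    -- exponential decay in depth plus weight, with constants that depend only on the noise
    (∃ κ : ℝ, 0 < κ ∧ ∃ m₀ : ℕ, ∀ (n L : ℕ), 1 ≤ L →
      ∀ (C : RandomCircuit n L) (P : Fin n → Fin 4) (ρ σ : Op n), IsState ρ → IsState σ →
        m₀ ≤ L + pauliWeight P →
        ∫ u, ‖(pauliString P * C.channel N u (ρ - σ)).trace‖ ^ 2 ∂C.law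
          ≤ Real.exp (-κ * ((L : ℝ) + (pauliWeight P : ℝ)))) ∧
    -- only the last layers matter, with constants that depend only on the noise
    (∃ κ : ℝ, 0 < κ ∧ ∃ l₀ : ℕ, ∀ (n L : ℕ)
      (C : RandomCircuit n L) (P : Fin n → Fin 4) (ρ₀ : Op n), IsState ρ₀ →
        ∀ l : ℕ, l₀ ≤ l → l ≤ L →
          Integrable (fun u => ‖(pauliString P * C.channel N u ρ₀).trace
            - (pauliString P * C.lastLayers N u l ρ₀).trace‖) C.law ∧
          ∫ u, ‖(pauliString P * C.channel N u ρ₀).trace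
            - (pauliString P * C.lastLayers N u l ρ₀).trace‖ ∂C.law
            ≤ Real.exp (-κ * (l : ℝ))) := by
  have hT := pauliTransfer_zero_left hN
  have hlt : noiseConst N < 1 :=
    not_le.mp fun h => hnu (isUnitaryChannel_of_one_le_noiseConst hN h)
  have hc0 := noiseConst_nonneg N
  obtain ⟨κ, hκ, m₀, hm₀⟩ := exists_exp_bound hc0 hlt
  -- Passing from the second to the first moment takes a square root and halves the rate; the
  -- maximum with 1 ensures that at least one layer is kept.
  refine ⟨exists_hasNormalForm hN, fun t D hnf => ?_, ⟨κ, hκ, m₀, ?_⟩, ⟨κ / 2, half_pos hκ,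
    max m₀ 1, ?_⟩⟩
  · rw [← noiseConst_eq_contraction hN hnf]
    refine ⟨hlt, fun n L hL C P => ⟨fun ρ σ hρ hσ => ?_, fun ρ hρ l hl1 hl => ?_⟩⟩
    · obtain ⟨h1, h2⟩ := C.secondMoment_channel_sub_le hT hlt.le hL P hρ hσ
      exact ⟨(h1.norm.pow 2).integrable_of_compactSpace, h2⟩
    · obtain ⟨h1, h2⟩ := C.secondMoment_channel_sub_lastLayers_le hT hlt.le P hρ hl1 hl
      exact ⟨(h1.norm.pow 2).integrable_of_compactSpace, h2⟩
  · intro n L hL C P ρ σ hρ hσ hm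
    refine (C.secondMoment_channel_sub_le hT hlt.le hL P hρ hσ).2.trans ?_
    rw [add_comm (pauliWeight P) L]
    exact_mod_cast hm₀ _ hm
  · intro n L C P ρ hρ l hl0 hl
    obtain ⟨h1, h2⟩ := C.secondMoment_channel_sub_lastLayers_le hT hlt.le P hρ
      ((le_max_right _ _).trans hl0) hl
    have hint := (h1.norm).integrable_of_compactSpace (μ := C.law)
    refine ⟨hint, integral_norm_le_of_integral_norm_sq_le hint
      (h1.norm.pow 2).integrable_of_compactSpace (Real.exp_pos _) (h2.trans ?_)⟩
    rw [← Real.exp_nat_mul, show ((2 : ℕ) : ℝ) * (-(κ / 2) * (l : ℝ)) = -κ * (l : ℝ) by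
      push_cast; ring]
    refine le_trans ?_ (hm₀ l ((le_max_left _ _).trans hl0))
    -- The weight of P only helps and is dropped from the exponent.
    exact mul_le_mul_of_nonneg_left (pow_le_pow_of_le_one hc0 hlt.le (by omega)) (by norm_num)
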